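/- Let $\mathbb{T}$ be a time scale (a nonempty closed subset of $\mathbb{R}$), let $a,b\in\mathbb{T}$ with $a<b$, and let $I=[a,b]\cap\mathbb{T}$, regarded as a time scale with its own jump operators $\sigma,\rho$ (so $\rho(a)=a$ and $\sigma(b)=b$); put $[a,b]_\kappa=I\setminus[a,\sigma(a))$ and $[a,b]^\kappa=I\setminus(\rho(b),b]$. Let $f,g:\mathbb{T}\times\mathbb{R}^2\to\mathbb{R}$ be continuous, with partial derivatives $\partial_2,\partial_3$ with respect to the second and third variables that exist and are continuous on $\mathbb{T}\times\mathbb{R}^2$, and let $\alpha,\beta,\Lambda\in\mathbb{R}$. Consider the problem of extremizing $$\int_a^b f\bigl(t,y^\rho(t),y^\nabla(t)\bigr)\,\nabla t \quad\text{subject to}\quad \int_a^b g\bigl(t,y^\rho(t),y^\nabla(t)\bigr)\,\nabla t=\Lambda,\qquad y(a)=\alpha,\quad y(b)=\beta,$$ in the class of functions $y:I\to\mathbb{R}$ such that $y^\nabla$ exists and is continuous on $[a,b]_\kappa$; here $y^\rho=y\circ\rho$ and $y^\sigma=y\circ\sigma$. Let $\hat y$ be a local minimizer or a local maximizer of this problem,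 that is, $\hat y$ is admissible and, for some $\delta>0$, is a minimizer (respectively a maximizer) among all admissible $y$ with $\|y-\hat y\|_{1,\infty}<\delta$, where $\|y\|_{1,\infty}=\|y^\sigma\|_\infty+\|y^\rho\|_\infty+\|y^\Delta\|_\infty+\|y^\nabla\|_\infty$ and $\|h\|_\infty=\sup\{|h(t)|:t\in[a,b]^\kappa\cap[a,b]_\kappa\}$. Then there exist two real constants $\lambda_0$ and $\lambda$, not both zero, such that, with $G(t,x,v)=\lambda_0f(t,x,v)-\lambda g(t,x,v)$, $$\frac{\nabla}{\nabla t}\Bigl[\partial_3G\bigl(t,\hat y^\rho(t),\hat y^\nabla(t)\bigr)\Bigr]-\partial_2G\bigl(t,\hat y^\rho(t),\hat y^\nabla(t)\bigr)=0\qquad\text{for all }t\in[a,b]_\kappa .$$ If $\sigma(a)>a$, then $\hat y^\nabla(a)$ is undefined, and the equation means that the function $t\mapsto\partial_3G(t,\hat y^\rho(t),\hat y^\nabla(t))$, which is defined on $[a,b]_\kappa=I\setminus\{a\}$, can be given a real value at $a$ so that the extended function on $I$ satisfies the equation at every $t\in[a,b]_\kappa$ (the value at $a$ enters only at $t=\sigma(a)$,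 so at all other points this is the equation as written). -/

import Mathlib

open Set Filter Topology MeasureTheory
open scoped ENNReal

noncomputable section

namespace TimeScale

/-- A time scale: a nonempty closed subset of the real line. -/
structure IsTimeScale (T : Set ℝ) : Prop where
  nonempty : T.Nonempty
  isClosed : IsClosed T

/-- The time scale interval `[a, b] ∩ T`; it is itself a time scale with minimum `a` and
maximum `b` when `a ≤ b` are points of `T`. -/
def interval (T : Set ℝ) (a b : ℝ) : Set ℝ := Icc a b ∩ T

open Classical in
/-- Forward jump operator of the time scale `S`: `σ(t) = inf {s ∈ S | t < s}`, and `σ(t) = t` at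
the maximum of `S`. -/
def sigma (S : Set ℝ) (t : ℝ) : ℝ :=
  if (S ∩ Ioi t).Nonempty then sInf (S ∩ Ioi t) else t

open Classical in
/-- Backward jump operator of the time scale `S`: `ρ(t) = sup {s ∈ S | s < t}`, and `ρ(t) = t` at
the minimum of `S`. -/
def rho (S : Set ℝ) (t : ℝ) : ℝ :=
  if (S ∩ Iio t).Nonempty then sSup (S ∩ Iio t) else t

/-- `S_κ = S \ [a, σ(a))`, for a time scale `S` with minimum `a`. -/
def lowerKappa (S : Set ℝ) (a : ℝ) : Set ℝ := S \ Ico a (sigma S a)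

/-- `S^κ = S \ (ρ(b), b]`, for a time scale `S` with maximum `b`. -/
def upperKappa (S : Set ℝ) (b : ℝ) : Set ℝ := S \ Ioc (rho S b) b

/-- `y` has delta derivative `d` at the point `t` of the time scale `S`. -/
def HasDeltaDerivAt (S : Set ℝ) (y : ℝ → ℝ) (d t : ℝ) : Prop :=
  ∀ ε > 0, ∃ δ > 0, ∀ s ∈ S, |s - t| < δ →
    |y (sigma S t) - y s - d * (sigma S t - s)| ≤ ε * |sigma S t - s|

/-- `y` has nabla derivative `d` at the point `t` of the time scale `S`. -/
def HasNablaDerivAt (S : Set ℝ) (y : ℝ → ℝ) (d t : ℝ) : Prop :=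
  ∀ ε > 0, ∃ δ > 0, ∀ s ∈ S, |s - t| < δ →
    |y (rho S t) - y s - d * (rho S t - s)| ≤ ε * |rho S t - s|

open Classical in
/-- The delta derivative `y^Δ(t)` (with the value `0` where it does not exist). -/
def deltaDeriv (S : Set ℝ) (y : ℝ → ℝ) (t : ℝ) : ℝ :=
  if h : ∃ d, HasDeltaDerivAt S y d t then h.choose else 0

open Classical in
/-- The nabla derivative `y^∇(t)` (with the value `0` where it does not exist). -/
def nablaDeriv (S : Set ℝ) (y : ℝ → ℝ) (t : ℝ) : ℝ :=
  if h : ∃ d, HasNablaDerivAt S y d t then h.choose else 0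

/-- The nabla integral `∫_a^b h(t) ∇t` over the time scale `S`, for `a ≤ b` in `S`: the integral
of `h` against the Lebesgue nabla measure of `S`, which gives `(s, t] ∩ S` the mass `t - s` for
`s ≤ t` in `S`. This measure is the image of Lebesgue measure on `(a, b]` under the map
`x ↦ min {s ∈ S | x ≤ s}`, which fixes the points of `S` and sends the gap `(ρ(t), t)` to `t`. -/
def nablaIntegral (S : Set ℝ) (a b : ℝ) (h : ℝ → ℝ) : ℝ :=
  ∫ x in a..b, h (sInf (S ∩ Ici x))

/-- The class of functions `y` on the time scale `S` with minimum `a` whose nabla derivative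
exists and is continuous on `S_κ`. Only the values of `y` on `S` matter. -/
def IsNablaC1 (S : Set ℝ) (a : ℝ) (y : ℝ → ℝ) : Prop :=
  (∀ t ∈ lowerKappa S a, ∃ d, HasNablaDerivAt S y d t) ∧
    ContinuousOn (nablaDeriv S y) (lowerKappa S a)

/-- The supremum norm of `h` over `S_κ ∩ S^κ`, where `S` has minimum `a` and maximum `b`. -/
def supNorm (S : Set ℝ) (a b : ℝ) (h : ℝ → ℝ) : ℝ≥0∞ :=
  ⨆ t ∈ lowerKappa S a ∩ upperKappa S b, ENNReal.ofReal |h t|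

/-- `‖y‖_{1,∞} = ‖y^σ‖_∞ + ‖y^ρ‖_∞ + ‖y^Δ‖_∞ + ‖y^∇‖_∞`. -/
def norm1 (S : Set ℝ) (a b : ℝ) (y : ℝ → ℝ) : ℝ≥0∞ :=
  supNorm S a b (fun t => y (sigma S t)) + supNorm S a b (fun t => y (rho S t)) +
    supNorm S a b (deltaDeriv S y) + supNorm S a b (nablaDeriv S y)

/-- Partial derivative with respect to the second variable. -/
def partial₂ (f : ℝ → ℝ → ℝ → ℝ) (t x v : ℝ) : ℝ := deriv (fun x' => f t x' v) x

/-- Partial derivative with respect to the third variable. -/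
def partial₃ (f : ℝ → ℝ → ℝ → ℝ) (t x v : ℝ) : ℝ := deriv (fun v' => f t x v') v

/-- The regularity required of a Lagrangian `f : T × ℝ × ℝ → ℝ`: `f` is continuous and the partial
derivatives `∂₂f` and `∂₃f` exist and are continuous, everything on `T × ℝ × ℝ`. -/
structure IsLagrangian (T : Set ℝ) (f : ℝ → ℝ → ℝ → ℝ) : Prop where
  continuousOn : ContinuousOn (fun p : ℝ × ℝ × ℝ => f p.1 p.2.1 p.2.2) (T ×ˢ univ)
  differentiable₂ : ∀ t ∈ T, ∀ v, Differentiable ℝ (fun x => f t x v)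
  differentiable₃ : ∀ t ∈ T, ∀ x, Differentiable ℝ (fun v => f t x v)
  continuousOn₂ : ContinuousOn (fun p : ℝ × ℝ × ℝ => partial₂ f p.1 p.2.1 p.2.2) (T ×ˢ univ)
  continuousOn₃ : ContinuousOn (fun p : ℝ × ℝ × ℝ => partial₃ f p.1 p.2.1 p.2.2) (T ×ˢ univ)

/-- `h{y}(t) = h(t, y^ρ(t), y^∇(t))`. -/
def along (S : Set ℝ) (h : ℝ → ℝ → ℝ → ℝ) (y : ℝ → ℝ) (t : ℝ) : ℝ :=
  h t (y (rho S t)) (nablaDeriv S y t)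

/-- The functional `y ↦ ∫_a^b f(t, y^ρ(t), y^∇(t)) ∇t`. -/
def functional (S : Set ℝ) (a b : ℝ) (f : ℝ → ℝ → ℝ → ℝ) (y : ℝ → ℝ) : ℝ :=
  nablaIntegral S a b (along S f y)

/-- `y` is admissible: it belongs to the class, satisfies the boundary conditions `y(a) = α`,
`y(b) = β` and the isoperimetric constraint `∫_a^b g(t, y^ρ(t), y^∇(t)) ∇t = Λ`. -/
structure IsAdmissible (S : Set ℝ) (a b α β Λ : ℝ) (g : ℝ → ℝ → ℝ → ℝ) (y : ℝ → ℝ) : Prop where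
  isNablaC1 : IsNablaC1 S a y
  left : y a = α
  right : y b = β
  constraint : functional S a b g y = Λ

/-- `yh` is a local minimizer of the nabla isoperimetric problem. -/
def IsLocalMinimizer (S : Set ℝ) (a b α β Λ : ℝ) (f g : ℝ → ℝ → ℝ → ℝ) (yh : ℝ → ℝ) : Prop :=
  IsAdmissible S a b α β Λ g yh ∧ ∃ δ : ℝ, 0 < δ ∧ ∀ y, IsAdmissible S a b α β Λ g y →
    norm1 S a b (fun t => y t - yh t) < ENNReal.ofReal δ →
      functional S a b f yh ≤ functional S a b f y

/-- `yh` is a local maximizer of the nabla isoperimetric problem. -/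
def IsLocalMaximizer (S : Set ℝ) (a b α β Λ : ℝ) (f g : ℝ → ℝ → ℝ → ℝ) (yh : ℝ → ℝ) : Prop :=
  IsAdmissible S a b α β Λ g yh ∧ ∃ δ : ℝ, 0 < δ ∧ ∀ y, IsAdmissible S a b α β Λ g y →
    norm1 S a b (fun t => y t - yh t) < ENNReal.ofReal δ →
      functional S a b f y ≤ functional S a b f yh

/-- The nabla Euler–Lagrange equation `(∂₃G{y})^∇ = ∂₂G{y}` at every point of `S_κ`, where `S` is
a time scale with minimum `a`. If `a` is right-dense, then `S_κ = S`, so `p` is the function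
`∂₃G{y}` itself. If `a` is right-scattered, then `S_κ = S \ {a}`: `y^∇(a)`, and with it
`∂₃G{y}(a)`, is undefined, while the nabla derivative at `σ(a)` refers to a value at
`ρ(σ(a)) = a`; then `p` is `∂₃G{y}` completed by some real value at `a`. -/
def EulerLagrange (S : Set ℝ) (a : ℝ) (G : ℝ → ℝ → ℝ → ℝ) (y : ℝ → ℝ) : Prop :=
  ∃ p : ℝ → ℝ, (∀ t ∈ lowerKappa S a, p t = along S (partial₃ G) y t) ∧
    ∀ t ∈ lowerKappa S a, HasNablaDerivAt S p (along S (partial₂ G) y t) t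

end TimeScale

end

open TimeScale

noncomputable section

namespace TimeScale

/-! Perturb `yh` by nabla primitives `U(t) = ∫_a^t u ∇x`, where `u` ranges over the Banach space of
bounded continuous functions on ℝ with the sup norm. A small `u` gives a perturbation small in
‖·‖_{1,∞}, so `u = 0` is a local extremum of the `f`-functional under two scalar constraints: the
isoperimetric one and `U(b) = 0`. Uniform continuity of ∂₂ and ∂₃ on compact sets makes both
functionals strictly differentiable at 0 (`exists_hasStrictFDerivAt_functional`), and the Lagrange
multiplier rule in a Banach space gives multipliers of `f`, `g` and `U(b)`, not all zero. That of
`U(b)` cannot be the only nonzero one, because `u = 1` gives `U(b) = b - a > 0`.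

Write `p = ∂₃G{yh}`, `q = ∂₂G{yh}`, and `c` for the multiplier of `U(b)`. Then `∫ (q U^ρ + p u) ∇t +
c U(b) = 0` for all `u`. Fubini (`integral_mul_primitive`) turns this into `∫ u(x) (p(x) + ∫_x^b q +
c) ∇x = 0`, so the bracket vanishes almost everywhere. It then vanishes everywhere on `S_κ`
(`duBoisReymond`): a left-scattered point is an atom, and at any other point the bracket is
continuous and every neighbourhood has positive measure. Hence `p(t) = ∫_a^t q + const`, and the
fundamental theorem `hasNablaDerivAt_integral` gives the equation. The integral formula also makes
sense at `a`, which supplies the missing value there. -/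

/-- A closed set `S ⊆ [a, b]` that contains `a < b`: a compact time scale with minimum `a` and
maximum `b`. -/
structure IsCompactScale (S : Set ℝ) (a b : ℝ) : Prop where
  isClosed : IsClosed S
  left_mem : a ∈ S
  right_mem : b ∈ S
  lt : a < b
  subset : S ⊆ Icc a b

theorem isCompactScale_interval {T : Set ℝ} (hT : IsTimeScale T) {a b : ℝ} (ha : a ∈ T)
    (hb : b ∈ T) (hab : a < b) : IsCompactScale (interval T a b) a b where
  isClosed := isClosed_Icc.inter hT.isClosed
  left_mem := ⟨left_mem_Icc.2 hab.le, ha⟩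
  right_mem := ⟨right_mem_Icc.2 hab.le, hb⟩
  lt := hab
  subset := inter_subset_left

/-! ### Jump operators and the points of `S_κ` and `S^κ`. -/

section Jump

variable {S : Set ℝ} {a b s t x : ℝ}

theorem rho_le (S : Set ℝ) (t : ℝ) : rho S t ≤ t := by
  unfold rho
  split_ifs with h
  · exact csSup_le h fun x hx => hx.2.le
  · exact le_rfl

theorem le_rho (hs : s ∈ S) (hst : s < t) : s ≤ rho S t := by
  rw [rho, if_pos ⟨s, hs, hst⟩]
  exact le_csSup ⟨t, fun x hx => hx.2.le⟩ ⟨hs, hst⟩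

theorem sigma_le (hs : s ∈ S) (hst : t < s) : sigma S t ≤ s := by
  rw [sigma, if_pos ⟨s, hs, hst⟩]
  exact csInf_le ⟨t, fun x hx => hx.2.le⟩ ⟨hs, hst⟩

theorem rho_mem (hS : IsClosed S) (ht : t ∈ S) : rho S t ∈ S := by
  unfold rho
  split_ifs with h
  · exact closure_minimal inter_subset_left hS
      (csSup_mem_closure h ⟨t, fun x hx => hx.2.le⟩)
  · exact ht

theorem sigma_mem (hS : IsClosed S) (ht : t ∈ S) : sigma S t ∈ S := by
  unfold sigma
  split_ifs with h
  · exact closure_minimal inter_subset_left hS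
      (csInf_mem_closure h ⟨t, fun x hx => hx.2.le⟩)
  · exact ht

/-- Needed on all of ℝ, not only on `S`: monotonicity is what makes `rho S` Borel measurable. -/
theorem monotone_rho (hS : IsCompactScale S a b) : Monotone (rho S) := by
  intro s t hst
  by_cases hs : (S ∩ Iio s).Nonempty
  · rw [rho, if_pos hs]
    exact csSup_le hs fun x hx => le_rho hx.1 (lt_of_lt_of_le hx.2 hst)
  · have hsa : s ≤ a := by
      by_contra! h
      exact hs ⟨a, hS.left_mem, h⟩
    by_cases ht : (S ∩ Iio t).Nonempty
    · obtain ⟨u, hu, hut⟩ := ht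
      exact (rho_le S s).trans (hsa.trans ((hS.subset hu).1.trans (le_rho hu hut)))
    · rw [rho, if_neg hs, rho, if_neg ht]
      exact hst

theorem lowerKappa_eq (hS : IsCompactScale S a b) : lowerKappa S a = S ∩ Ici (sigma S a) := by
  ext t
  simp only [lowerKappa, Set.mem_sdiff, mem_Ico, not_and, not_lt, mem_inter_iff, mem_Ici]
  exact ⟨fun h => ⟨h.1, h.2 (hS.subset h.1).1⟩, fun h => ⟨h.1, fun _ => h.2⟩⟩

theorem isClosed_lowerKappa (hS : IsCompactScale S a b) : IsClosed (lowerKappa S a) := by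
  rw [lowerKappa_eq hS]
  exact hS.isClosed.inter isClosed_Ici

theorem isCompact_lowerKappa (hS : IsCompactScale S a b) : IsCompact (lowerKappa S a) :=
  isCompact_Icc.of_isClosed_subset (isClosed_lowerKappa hS)
    fun _ ht => hS.subset ht.1

theorem mem_lowerKappa_of_lt (hS : IsCompactScale S a b) (ht : t ∈ S) (h : a < t) :
    t ∈ lowerKappa S a := by
  rw [lowerKappa_eq hS]
  exact ⟨ht, sigma_le ht h⟩

/-- A point of `S_κ` that is not left-scattered is an accumulation point of `S`. -/
theorem exists_near_of_rho_eq (hS : IsCompactScale S a b) (ht : t ∈ lowerKappa S a)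
    (hρ : rho S t = t) {δ : ℝ} (hδ : 0 < δ) : ∃ s ∈ S, |s - t| < δ ∧ s ≠ t := by
  rcases (hS.subset ht.1).1.eq_or_lt with rfl | hat
  · have hne : (S ∩ Ioi a).Nonempty := ⟨b, hS.right_mem, hS.lt⟩
    have hσ : sigma S a ≤ a := by
      have := ht.2
      simpa using this
    rw [sigma, if_pos hne] at hσ
    obtain ⟨s, hs, hlt⟩ := exists_lt_of_csInf_lt hne (lt_of_le_of_lt hσ (lt_add_of_pos_right a hδ))
    have := hs.2
    rw [mem_Ioi] at this
    exact ⟨s, hs.1, by rw [abs_of_pos] <;> linarith, this.ne'⟩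
  · have hne : (S ∩ Iio t).Nonempty := ⟨a, hS.left_mem, hat⟩
    rw [rho, if_pos hne] at hρ
    obtain ⟨s, hs, hlt⟩ := exists_lt_of_lt_csSup hne
      (show t - δ < sSup (S ∩ Iio t) by rw [hρ]; linarith)
    have := hs.2
    rw [mem_Iio] at this
    exact ⟨s, hs.1, by rw [abs_of_neg] <;> linarith, this.ne⟩

/-- Supplies the points at which the factor `|rho S t - s|` of the derivative estimate can be
cancelled. At a left-scattered `t`, the point `s = t` itself serves. -/
theorem exists_near_ne_rho (hS : IsCompactScale S a b) (ht : t ∈ lowerKappa S a) {δ : ℝ}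
    (hδ : 0 < δ) : ∃ s ∈ S, |s - t| < δ ∧ s ≠ rho S t := by
  by_cases hρ : rho S t = t
  · obtain ⟨s, hs, h1, h2⟩ := exists_near_of_rho_eq hS ht hρ hδ
    exact ⟨s, hs, h1, by rwa [hρ]⟩
  · exact ⟨t, ht.1, by simpa using hδ, fun h => hρ h.symm⟩

theorem exists_near_ne_sigma (hS : IsCompactScale S a b) (ht : t ∈ upperKappa S b) {δ : ℝ}
    (hδ : 0 < δ) : ∃ s ∈ S, |s - t| < δ ∧ s ≠ sigma S t := by
  by_cases hσ : sigma S t = t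
  swap
  · exact ⟨t, ht.1, by simpa using hδ, fun h => hσ h.symm⟩
  rw [hσ]
  rcases (hS.subset ht.1).2.eq_or_lt with rfl | htb
  · have hne : (S ∩ Iio t).Nonempty := ⟨a, hS.left_mem, hS.lt⟩
    have hρ : t ≤ rho S t := by
      have := ht.2
      simpa using this
    rw [rho, if_pos hne] at hρ
    obtain ⟨s, hs, hlt⟩ := exists_lt_of_lt_csSup hne
      (show t - δ < sSup (S ∩ Iio t) by linarith)
    have := hs.2
    rw [mem_Iio] at this
    exact ⟨s, hs.1, by rw [abs_of_neg] <;> linarith, this.ne⟩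
  · have hne : (S ∩ Ioi t).Nonempty := ⟨b, hS.right_mem, htb⟩
    rw [sigma, if_pos hne] at hσ
    obtain ⟨s, hs, hlt⟩ := exists_lt_of_csInf_lt hne
      (show sInf (S ∩ Ioi t) < t + δ by linarith)
    have := hs.2
    rw [mem_Ioi] at this
    exact ⟨s, hs.1, by rw [abs_of_pos] <;> linarith, this.ne'⟩

/-- At a point that is not left-scattered, the backward jump operator is continuous along `S`. -/
theorem continuousWithinAt_rho (hρ : rho S t = t) : ContinuousWithinAt (rho S) S t := by
  rw [Metric.continuousWithinAt_iff]
  intro ε hε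
  rcases (S ∩ Iio t).eq_empty_or_nonempty with he | hne
  · refine ⟨ε, hε, fun {s} hs hst => ?_⟩
    rw [Real.dist_eq] at hst ⊢
    rw [hρ]
    have hts : t ≤ s := by
      by_contra! h
      exact (he ▸ (⟨hs, h⟩ : s ∈ S ∩ Iio t) : s ∈ (∅ : Set ℝ))
    have h1 := rho_le S s
    have h2 : t ≤ rho S s := by
      by_cases hn : (S ∩ Iio s).Nonempty
      · obtain ⟨u, hu, hus⟩ := hn
        have : t ≤ u := by
          by_contra! h
          exact (he ▸ (⟨hu, h⟩ : u ∈ S ∩ Iio t) : u ∈ (∅ : Set ℝ))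
        exact this.trans (le_rho hu hus)
      · rw [rho, if_neg hn]; exact hts
    rw [abs_of_nonneg (by linarith)] at hst ⊢
    linarith
  · have hsup : sSup (S ∩ Iio t) = t := by rwa [rho, if_pos hne] at hρ
    obtain ⟨u, hu, hlt⟩ := exists_lt_of_lt_csSup hne (show t - ε < sSup (S ∩ Iio t) by linarith)
    have hut := hu.2
    rw [mem_Iio] at hut
    -- Once `s > u`, the point `u` of `S` bounds `rho S s` from below, and `u > t - ε`.
    refine ⟨min ε (t - u), lt_min hε (by linarith), fun {s} hs hst => ?_⟩
    rw [Real.dist_eq] at hst ⊢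
    have h1 := (abs_lt.1 hst).1
    have h2 := (abs_lt.1 hst).2
    have h3 := min_le_left ε (t - u)
    have h4 := min_le_right ε (t - u)
    have h5 := le_rho hu.1 (show u < s by linarith)
    have h6 := rho_le S s
    rw [hρ, abs_lt]
    constructor <;> linarith

end Jump

/-! ### The nabla measure as an image of Lebesgue measure. -/

section Measure

variable {S : Set ℝ} {a b s t x : ℝ}

/-- The Lebesgue nabla measure of the time scale `S` with minimum `a` and maximum `b`. -/
def nablaMeasure (S : Set ℝ) (a b : ℝ) : Measure ℝ :=
  (volume.restrict (Ioc a b)).map fun x => sInf (S ∩ Ici x)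

theorem ceil_mem (hS : IsCompactScale S a b) (hx : x ≤ b) : sInf (S ∩ Ici x) ∈ S ∩ Ici x :=
  (hS.isClosed.inter isClosed_Ici).csInf_mem ⟨b, hS.right_mem, hx⟩ ⟨x, fun _ h => h.2⟩

theorem ceil_le (hs : s ∈ S) (hx : x ≤ s) : sInf (S ∩ Ici x) ≤ s :=
  csInf_le ⟨x, fun _ h => h.2⟩ ⟨hs, hx⟩

theorem aemeasurable_ceil (hS : IsCompactScale S a b) :
    AEMeasurable (fun x => sInf (S ∩ Ici x)) (volume.restrict (Ioc a b)) := by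
  refine aemeasurable_restrict_of_monotoneOn measurableSet_Ioc fun x _ y hy hxy => ?_
  have := ceil_mem hS hy.2
  exact ceil_le this.1 (hxy.trans this.2)

instance isFiniteMeasure_nablaMeasure : IsFiniteMeasure (nablaMeasure S a b) := by
  unfold nablaMeasure
  infer_instance

/-- For `x` in `(a, b]`, the least point of `S` above `x` exceeds `a`. Hence default values outside
`S_κ` never affect an integral. -/
theorem ae_mem_lowerKappa (hS : IsCompactScale S a b) :
    ∀ᵐ t ∂nablaMeasure S a b, t ∈ lowerKappa S a := by
  refine (ae_map_iff (aemeasurable_ceil hS) (isClosed_lowerKappa hS).measurableSet).2 ?_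
  filter_upwards [ae_restrict_mem measurableSet_Ioc] with x hx
  have := ceil_mem hS hx.2
  exact mem_lowerKappa_of_lt hS this.1 (lt_of_lt_of_le hx.1 this.2)

theorem nablaIntegral_eq (hS : IsCompactScale S a b) {h : ℝ → ℝ}
    (hh : AEStronglyMeasurable h (nablaMeasure S a b)) :
    nablaIntegral S a b h = ∫ t, h t ∂nablaMeasure S a b := by
  rw [nablaIntegral, intervalIntegral.integral_of_le hS.lt.le, nablaMeasure,
    integral_map (aemeasurable_ceil hS) hh]

/-- For `s`, `t` in `S` and `x ≤ b`, the least point of `S` above `x` lies in `(s, t]` exactly when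
`x` does. -/
theorem nablaMeasure_Ioc (hS : IsCompactScale S a b) (hs : s ∈ S) (ht : t ∈ S) :
    nablaMeasure S a b (Ioc s t) = ENNReal.ofReal (t - s) := by
  rw [nablaMeasure, Measure.map_apply_of_aemeasurable (aemeasurable_ceil hS) measurableSet_Ioc,
    Measure.restrict_apply' measurableSet_Ioc, ← Real.volume_Ioc]
  congr 1
  have h1 := hS.subset hs
  have h2 := hS.subset ht
  ext x
  simp only [mem_inter_iff, mem_preimage, mem_Ioc]
  constructor
  · rintro ⟨⟨h3, h4⟩, h5, h6⟩
    refine ⟨?_, (ceil_mem hS h6).2.trans h4⟩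
    by_contra! h
    exact (ceil_le hs h).not_gt h3
  · rintro ⟨h3, h4⟩
    have h5 : x ≤ b := h4.trans h2.2
    exact ⟨⟨lt_of_lt_of_le h3 (ceil_mem hS h5).2, ceil_le ht h4⟩, lt_of_le_of_lt h1.1 h3, h5⟩

theorem nablaMeasure_uIoc (hS : IsCompactScale S a b) (hs : s ∈ S) (ht : t ∈ S) :
    nablaMeasure S a b (uIoc s t) = ENNReal.ofReal |t - s| := by
  rcases le_total s t with h | h
  · rw [uIoc_of_le h, nablaMeasure_Ioc hS hs ht, abs_of_nonneg (by linarith)]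
  · rw [uIoc_of_ge h, nablaMeasure_Ioc hS ht hs, abs_of_nonpos (by linarith), neg_sub]

theorem ae_mem_Ioc (hS : IsCompactScale S a b) : ∀ᵐ t ∂nablaMeasure S a b, t ∈ Ioc a b := by
  refine (ae_map_iff (aemeasurable_ceil hS) measurableSet_Ioc).2 ?_
  filter_upwards [ae_restrict_mem measurableSet_Ioc] with x hx
  have := ceil_mem hS hx.2
  exact ⟨lt_of_lt_of_le hx.1 this.2, (hS.subset this.1).2⟩

/-- A property that holds almost everywhere holds at the left-scattered points. -/
theorem of_ae_of_rho_lt (hS : IsCompactScale S a b) (ht : t ∈ S) (hρ : rho S t < t) {P : ℝ → Prop}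
    (h : ∀ᵐ x ∂nablaMeasure S a b, P x) : P t := by
  have hpos : nablaMeasure S a b (Ioc (rho S t) t) ≠ 0 := by
    rw [nablaMeasure_Ioc hS (rho_mem hS.isClosed ht) ht]
    simpa using hρ
  obtain ⟨x, hx, hP, hK⟩ := ((frequently_ae_mem_iff.2 hpos).and_eventually
    (h.and (ae_mem_lowerKappa hS))).exists
  -- No point of `S` lies strictly between `ρ(t)` and `t`.
  have hxt : x = t := by
    refine le_antisymm hx.2 ?_
    by_contra! hlt
    exact (le_rho hK.1 hlt).not_gt hx.1
  rwa [← hxt]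

/-- A property that holds almost everywhere holds frequently near the other points of `S_κ`. -/
theorem frequently_of_ae_of_rho_eq (hS : IsCompactScale S a b) (ht : t ∈ lowerKappa S a)
    (hρ : rho S t = t) {P : ℝ → Prop} (h : ∀ᵐ x ∂nablaMeasure S a b, P x) :
    ∃ᶠ x in 𝓝[lowerKappa S a] t, P x := by
  rw [Metric.nhdsWithin_basis_ball.frequently_iff]
  intro δ hδ
  obtain ⟨s, hs, hst, hne⟩ := exists_near_of_rho_eq hS ht hρ hδ
  have hpos : nablaMeasure S a b (uIoc t s) ≠ 0 := by
    rw [nablaMeasure_uIoc hS ht.1 hs]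
    simpa [sub_eq_zero] using hne
  obtain ⟨x, hx, hP, hK⟩ := ((frequently_ae_mem_iff.2 hpos).and_eventually
    (h.and (ae_mem_lowerKappa hS))).exists
  refine ⟨x, ⟨?_, hK⟩, hP⟩
  rw [Metric.mem_ball, Real.dist_eq]
  exact (abs_sub_left_of_mem_uIcc (uIoc_subset_uIcc hx)).trans_lt hst

end Measure

end TimeScale

end

noncomputable section

namespace TimeScale

/-! ### Nabla derivatives and the fundamental theorem. -/

section Calculus

variable {S : Set ℝ} {a b s t : ℝ} {y z q : ℝ → ℝ} {d e C : ℝ}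

theorem HasNablaDerivAt.add (hy : HasNablaDerivAt S y d t) (hz : HasNablaDerivAt S z e t) :
    HasNablaDerivAt S (fun x => y x + z x) (d + e) t := by
  intro ε hε
  obtain ⟨δ₁, h₁, H₁⟩ := hy (ε / 2) (by positivity)
  obtain ⟨δ₂, h₂, H₂⟩ := hz (ε / 2) (by positivity)
  refine ⟨min δ₁ δ₂, lt_min h₁ h₂, fun s hs hst => ?_⟩
  have h3 := H₁ s hs (hst.trans_le (min_le_left _ _))
  have h4 := H₂ s hs (hst.trans_le (min_le_right _ _))
  calc |y (rho S t) + z (rho S t) - (y s + z s) - (d + e) * (rho S t - s)|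
      = |(y (rho S t) - y s - d * (rho S t - s)) + (z (rho S t) - z s - e * (rho S t - s))| := by
        congr 1; ring
    _ ≤ _ := abs_add_le _ _
    _ ≤ ε / 2 * |rho S t - s| + ε / 2 * |rho S t - s| := add_le_add h3 h4
    _ = ε * |rho S t - s| := by ring

theorem hasNablaDerivAt_const (S : Set ℝ) (c t : ℝ) : HasNablaDerivAt S (fun _ => c) 0 t :=
  fun ε hε => ⟨1, one_pos, fun s _ _ => by simpa using by positivity⟩

theorem HasNablaDerivAt.unique (hS : IsCompactScale S a b) (ht : t ∈ lowerKappa S a)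
    (hd : HasNablaDerivAt S y d t) (he : HasNablaDerivAt S y e t) : d = e := by
  refine eq_of_forall_dist_le fun ε hε => ?_
  obtain ⟨δ₁, h₁, H₁⟩ := hd (ε / 2) (by positivity)
  obtain ⟨δ₂, h₂, H₂⟩ := he (ε / 2) (by positivity)
  obtain ⟨s, hs, hst, hne⟩ := exists_near_ne_rho hS ht (lt_min h₁ h₂)
  have h3 := H₁ s hs (hst.trans_le (min_le_left _ _))
  have h4 := H₂ s hs (hst.trans_le (min_le_right _ _))
  have hpos : 0 < |rho S t - s| := abs_pos.2 (sub_ne_zero.2 hne.symm)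
  rw [Real.dist_eq]
  refine le_of_mul_le_mul_right ?_ hpos
  rw [← abs_mul]
  calc |(d - e) * (rho S t - s)|
      = |(y (rho S t) - y s - e * (rho S t - s)) - (y (rho S t) - y s - d * (rho S t - s))| := by
        congr 1; ring
    _ ≤ _ := abs_sub _ _
    _ ≤ ε / 2 * |rho S t - s| + ε / 2 * |rho S t - s| := add_le_add h4 h3
    _ = ε * |rho S t - s| := by ring

theorem HasNablaDerivAt.nablaDeriv_eq (hS : IsCompactScale S a b) (ht : t ∈ lowerKappa S a)
    (hd : HasNablaDerivAt S y d t) : nablaDeriv S y t = d := by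
  have h : ∃ d, HasNablaDerivAt S y d t := ⟨d, hd⟩
  rw [nablaDeriv, dif_pos h]
  exact h.choose_spec.unique hS ht hd

theorem IsNablaC1.hasNablaDerivAt (hy : IsNablaC1 S a y) (ht : t ∈ lowerKappa S a) :
    HasNablaDerivAt S y (nablaDeriv S y t) t := by
  have h := hy.1 t ht
  rw [nablaDeriv, dif_pos h]
  exact h.choose_spec

/-- The derivative estimate compares `y s` with `y (rho S t)`, not with `y t`; it is applied at `s`
and at `t`, and the two are subtracted. -/
theorem HasNablaDerivAt.continuousWithinAt (ht : t ∈ S) (hy : HasNablaDerivAt S y d t) :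
    ContinuousWithinAt y S t := by
  rw [Metric.continuousWithinAt_iff]
  intro ε hε
  set M := |rho S t - t| with hM
  have hM0 : 0 ≤ M := abs_nonneg _
  -- The two estimates leave an error of at most `η (2M + 1)`, which does not shrink with `s - t`
  -- when `t` is left-scattered, so `η` must absorb `M`.
  set η := ε / (2 * (2 * M + 1)) with hη
  have hη0 : 0 < η := by positivity
  have hηM : η * (2 * M + 1) = ε / 2 := by rw [hη]; field_simp
  obtain ⟨δ, hδ, H⟩ := hy η hη0
  refine ⟨min δ (min 1 (ε / (2 * (|d| + 1)))), by positivity, fun {s} hs hst => ?_⟩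
  rw [Real.dist_eq] at hst ⊢
  have h1 := H s hs (hst.trans_le (min_le_left _ _))
  have h2 := H t ht (by simpa using hδ)
  have h3 : |s - t| < 1 := hst.trans_le ((min_le_right _ _).trans (min_le_left _ _))
  have h4 : |s - t| < ε / (2 * (|d| + 1)) :=
    hst.trans_le ((min_le_right _ _).trans (min_le_right _ _))
  have h5 : |d| * |s - t| ≤ |d| * (ε / (2 * (|d| + 1))) := by gcongr
  have h6 : |d| * (ε / (2 * (|d| + 1))) < ε / 2 := by
    have : (|d| + 1) * (ε / (2 * (|d| + 1))) = ε / 2 := by field_simp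
    have h7 : 0 < ε / (2 * (|d| + 1)) := by positivity
    linarith
  have h8 : |rho S t - s| ≤ M + |s - t| := by
    rw [hM, abs_sub_comm s t]
    calc |rho S t - s| = |(rho S t - t) + (t - s)| := by congr 1; ring
      _ ≤ _ := abs_add_le _ _
  calc |y s - y t|
      = |(y (rho S t) - y t - d * (rho S t - t)) - (y (rho S t) - y s - d * (rho S t - s))
          + d * (s - t)| := by congr 1; ring
    _ ≤ |(y (rho S t) - y t - d * (rho S t - t)) - (y (rho S t) - y s - d * (rho S t - s))|
          + |d * (s - t)| := abs_add_le _ _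
    _ ≤ |y (rho S t) - y t - d * (rho S t - t)| + |y (rho S t) - y s - d * (rho S t - s)|
          + |d * (s - t)| := by gcongr; exact abs_sub _ _
    _ ≤ η * M + η * (M + |s - t|) + |d| * |s - t| := by
        rw [abs_mul]
        gcongr
        exact h1.trans (by gcongr)
    _ ≤ η * (2 * M + 1) + |d| * |s - t| := by nlinarith
    _ < ε := by linarith

theorem IsNablaC1.continuousOn (hS : IsCompactScale S a b) (hy : IsNablaC1 S a y) :
    ContinuousOn y S := by
  intro t ht
  by_cases hK : t ∈ lowerKappa S a
  · exact (hy.hasNablaDerivAt hK).continuousWithinAt ht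
  · have h : t ∈ Ico a (sigma S a) := by
      by_contra h
      exact hK ⟨ht, h⟩
    have hta : t = a := by
      refine le_antisymm ?_ h.1
      by_contra! hlt
      exact (sigma_le ht hlt).not_gt h.2
    have hev : ∀ᶠ s in 𝓝[S] t, s = t := by
      filter_upwards [self_mem_nhdsWithin, mem_nhdsWithin_of_mem_nhds (Iio_mem_nhds h.2)]
        with s hs hlt
      refine le_antisymm ?_ (hta ▸ (hS.subset hs).1)
      by_contra! hts
      rw [hta] at hts
      exact (sigma_le hs hts).not_gt hlt
    refine tendsto_nhds_of_eventually_eq ?_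
    filter_upwards [hev] with s hs
    rw [hs]

theorem abs_intervalIntegral_le (hS : IsCompactScale S a b) (hs : s ∈ S) (ht : t ∈ S)
    (h : ∀ x ∈ lowerKappa S a, x ∈ uIoc s t → |q x| ≤ C) :
    |∫ x in s..t, q x ∂nablaMeasure S a b| ≤ C * |t - s| := by
  have h1 := intervalIntegral.norm_integral_eq_norm_integral_uIoc (a := s) (b := t)
    (μ := nablaMeasure S a b) q
  rw [← Real.norm_eq_abs, h1]
  refine (norm_setIntegral_le_of_norm_le_const_ae (C := C) (measure_lt_top _ _) ?_).trans_eq ?_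
  · filter_upwards [ae_restrict_mem measurableSet_uIoc, ae_restrict_of_ae (ae_mem_lowerKappa hS)]
      with x hx hK
    exact h x hK hx
  · rw [Measure.real, nablaMeasure_uIoc hS hs ht, ENNReal.toReal_ofReal (abs_nonneg _)]

theorem intervalIntegral_const (hS : IsCompactScale S a b) (hs : s ∈ S) (ht : t ∈ S) (c : ℝ) :
    ∫ _ in s..t, c ∂nablaMeasure S a b = c * (t - s) := by
  rw [intervalIntegral.integral_const', Measure.real, Measure.real, nablaMeasure_Ioc hS hs ht,
    nablaMeasure_Ioc hS ht hs, smul_eq_mul, mul_comm]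
  congr 1
  rcases le_total s t with h | h
  · rw [ENNReal.toReal_ofReal (by linarith), ENNReal.ofReal_of_nonpos (by linarith)]
    simp
  · rw [ENNReal.ofReal_of_nonpos (by linarith), ENNReal.toReal_ofReal (by linarith)]
    simp

/-- The fundamental theorem of nabla calculus; continuity of the integrand is needed only at the
points that are not left-scattered. -/
theorem hasNablaDerivAt_integral (hS : IsCompactScale S a b)
    (hq : Integrable q (nablaMeasure S a b)) (hC : ∀ x ∈ lowerKappa S a, |q x| ≤ C)
    (ht : t ∈ lowerKappa S a)
    (hcont : rho S t = t → ContinuousWithinAt q (lowerKappa S a) t) :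
    HasNablaDerivAt S (fun r => ∫ x in a..r, q x ∂nablaMeasure S a b) (q t) t := by
  have hρm := rho_mem hS.isClosed ht.1
  have key : ∀ s ∈ S, (∫ x in a..rho S t, q x ∂nablaMeasure S a b) -
      (∫ x in a..s, q x ∂nablaMeasure S a b) - q t * (rho S t - s) =
      ∫ x in s..rho S t, (q x - q t) ∂nablaMeasure S a b := by
    intro s hs
    rw [intervalIntegral.integral_interval_sub_left hq.intervalIntegrable hq.intervalIntegrable,
      intervalIntegral.integral_sub hq.intervalIntegrable (integrable_const _).intervalIntegrable,
      intervalIntegral_const hS hs hρm]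
  intro ε hε
  by_cases hρ : rho S t = t
  · obtain ⟨δ, hδ, H⟩ := Metric.continuousWithinAt_iff.1 (hcont hρ) ε hε
    refine ⟨δ, hδ, fun s hs hst => ?_⟩
    rw [key s hs]
    refine abs_intervalIntegral_le hS hs hρm fun x hK hx => ?_
    rw [hρ] at hx
    refine (H hK ?_).le
    rw [Real.dist_eq]
    have := abs_sub_right_of_mem_uIcc (uIoc_subset_uIcc hx)
    rw [abs_sub_comm] at this
    rw [abs_sub_comm] at hst
    exact this.trans_lt hst
  · have hlt : rho S t < t := lt_of_le_of_ne (rho_le S t) hρ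
    have hC0 : 0 ≤ C := (abs_nonneg _).trans (hC t ht)
    have hg : 0 < t - rho S t := by linarith
    -- At a left-scattered `t` the increment `ρ(t) - s` does not tend to 0. The first radius forces
    -- `s ≥ t`; the second makes the integral from `t` to `s`, at most `2C|t - s|`, smaller than `ε
    -- (t - ρ(t))`. On `(ρ(t), t]` the only point of `S` is `t`, so nothing is lost there.
    refine ⟨min (t - rho S t) (ε * (t - rho S t) / (2 * C + 1)), by positivity,
      fun s hs hst => ?_⟩
    have h1 : t ≤ s := by
      by_contra! h
      have h2 := le_rho hs h
      have h3 := (hst.trans_le (min_le_left _ _))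
      rw [abs_lt] at h3
      linarith [h3.1]
    have hint : Integrable (fun x => q x - q t) (nablaMeasure S a b) :=
      hq.sub (integrable_const _)
    rw [key s hs, ← intervalIntegral.integral_add_adjacent_intervals (b := t)
      hint.intervalIntegrable hint.intervalIntegrable]
    have h2 : |∫ x in t..rho S t, (q x - q t) ∂nablaMeasure S a b| ≤ 0 * |rho S t - t| := by
      refine abs_intervalIntegral_le hS ht.1 hρm fun x hK hx => ?_
      rw [uIoc_of_ge hlt.le] at hx
      have : x = t := by
        refine le_antisymm hx.2 ?_
        by_contra! hlt
        exact (le_rho hK.1 hlt).not_gt hx.1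
      simp [this]
    have h3 : |∫ x in s..t, (q x - q t) ∂nablaMeasure S a b| ≤ (2 * C) * |t - s| := by
      refine abs_intervalIntegral_le hS hs ht.1 fun x hK _ => ?_
      linarith [abs_sub (q x) (q t), hC x hK, hC t ht]
    have h4 : |t - s| ≤ ε * (t - rho S t) / (2 * C + 1) := by
      rw [abs_sub_comm]
      exact (hst.trans_le (min_le_right _ _)).le
    rw [le_div_iff₀ (by positivity)] at h4
    have h5 : |rho S t - s| = s - rho S t := by rw [abs_of_neg] <;> linarith
    rw [h5]
    rw [zero_mul] at h2
    have h6 : ε * (t - rho S t) ≤ ε * (s - rho S t) := by gcongr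
    linarith [abs_add_le (∫ x in s..t, (q x - q t) ∂nablaMeasure S a b)
      (∫ x in t..rho S t, (q x - q t) ∂nablaMeasure S a b), abs_nonneg (t - s)]

/-- A delta derivative of a function that is Lipschitz on `S` is bounded by the constant. -/
theorem abs_deltaDeriv_le (hS : IsCompactScale S a b) (hC : 0 ≤ C)
    (hy : ∀ s ∈ S, ∀ t ∈ S, |y t - y s| ≤ C * |t - s|) (ht : t ∈ upperKappa S b) :
    |deltaDeriv S y t| ≤ C := by
  unfold deltaDeriv
  split_ifs with h
  swap
  -- Where no delta derivative exists its value is 0, so existence need not be decided.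
  · simpa using hC
  refine le_of_forall_pos_le_add fun ε hε => ?_
  obtain ⟨δ, hδ, H⟩ := h.choose_spec ε hε
  obtain ⟨s, hs, hst, hne⟩ := exists_near_ne_sigma hS ht hδ
  have h1 := H s hs hst
  have h2 := hy s hs _ (sigma_mem hS.isClosed ht.1)
  have hpos : 0 < |sigma S t - s| := abs_pos.2 (sub_ne_zero.2 hne.symm)
  refine le_of_mul_le_mul_right ?_ hpos
  rw [← abs_mul]
  calc |h.choose * (sigma S t - s)|
      = |(y (sigma S t) - y s) - (y (sigma S t) - y s - h.choose * (sigma S t - s))| := by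
        congr 1; ring
    _ ≤ _ := abs_sub _ _
    _ ≤ C * |sigma S t - s| + ε * |sigma S t - s| := add_le_add h2 h1
    _ = (C + ε) * |sigma S t - s| := by ring

theorem supNorm_le {h : ℝ → ℝ} (H : ∀ t ∈ lowerKappa S a ∩ upperKappa S b, |h t| ≤ C) :
    supNorm S a b h ≤ ENNReal.ofReal C :=
  iSup₂_le fun t ht => ENNReal.ofReal_le_ofReal (H t ht)

end Calculus

end TimeScale

end

noncomputable section

namespace TimeScale

/-! ### Integrands along a curve and differentiability of integral functionals. -/

section Superposition

/-- The data are continuous only on `S`, `S_κ` or `S ×ˢ univ`; extension by zero gives Borel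
functions that can be composed. -/
theorem exists_measurable_eqOn {α : Type*} [TopologicalSpace α] [MeasurableSpace α]
    [OpensMeasurableSpace α] {g : α → ℝ} {s : Set α} (hg : ContinuousOn g s)
    (hs : MeasurableSet s) : ∃ g' : α → ℝ, Measurable g' ∧ EqOn g g' s := by
  classical
  exact ⟨s.piecewise g 0, hg.measurable_piecewise continuousOn_const hs,
    fun x hx => (piecewise_eq_of_mem s g 0 hx).symm⟩

variable {S T : Set ℝ} {a b t : ℝ} {y v : ℝ → ℝ} {f : ℝ → ℝ → ℝ → ℝ}

theorem aestronglyMeasurable_comp (hS : IsCompactScale S a b) (hy : ContinuousOn y S)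
    (hv : ContinuousOn v (lowerKappa S a))
    (hf : ContinuousOn (fun p : ℝ × ℝ × ℝ => f p.1 p.2.1 p.2.2) (S ×ˢ univ)) :
    AEStronglyMeasurable (fun t => f t (y (rho S t)) (v t)) (nablaMeasure S a b) := by
  obtain ⟨y', hy', hyy⟩ := exists_measurable_eqOn hy hS.isClosed.measurableSet
  obtain ⟨v', hv', hvv⟩ := exists_measurable_eqOn hv (isClosed_lowerKappa hS).measurableSet
  obtain ⟨f', hf', hff⟩ := exists_measurable_eqOn hf
    (hS.isClosed.measurableSet.prod MeasurableSet.univ)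
  have hm : Measurable fun t => f' (t, y' (rho S t), v' t) :=
    hf'.comp (measurable_id.prodMk ((hy'.comp (monotone_rho hS).measurable).prodMk hv'))
  refine hm.aestronglyMeasurable.congr ?_
  filter_upwards [ae_mem_lowerKappa hS] with t ht
  rw [← hyy (rho_mem hS.isClosed ht.1), ← hvv ht,
    ← hff (show (t, y (rho S t), v t) ∈ S ×ˢ univ from ⟨ht.1, trivial⟩)]

/-- The curve `(t, y(ρ(t)), v(t))` need not be continuous, since `ρ` may jump, but it stays in a
product of compact sets. -/
theorem exists_bound_comp (hS : IsCompactScale S a b) (hy : ContinuousOn y S)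
    (hv : ContinuousOn v (lowerKappa S a))
    (hf : ContinuousOn (fun p : ℝ × ℝ × ℝ => f p.1 p.2.1 p.2.2) (S ×ˢ univ)) :
    ∃ C, ∀ t ∈ lowerKappa S a, |f t (y (rho S t)) (v t)| ≤ C := by
  have hSc : IsCompact S := isCompact_Icc.of_isClosed_subset hS.isClosed hS.subset
  have hc : IsCompact (S ×ˢ (y '' S) ×ˢ (v '' lowerKappa S a)) :=
    hSc.prod ((hSc.image_of_continuousOn hy).prod
      ((isCompact_lowerKappa hS).image_of_continuousOn hv))
  obtain ⟨C, hC⟩ := hc.exists_bound_of_continuousOn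
    (hf.mono (prod_mono_right (subset_univ _)))
  exact ⟨C, fun t ht => hC (t, y (rho S t), v t)
    ⟨ht.1, mem_image_of_mem y (rho_mem hS.isClosed ht.1), mem_image_of_mem v ht⟩⟩

theorem integrable_comp (hS : IsCompactScale S a b) (hy : ContinuousOn y S)
    (hv : ContinuousOn v (lowerKappa S a))
    (hf : ContinuousOn (fun p : ℝ × ℝ × ℝ => f p.1 p.2.1 p.2.2) (S ×ˢ univ)) :
    Integrable (fun t => f t (y (rho S t)) (v t)) (nablaMeasure S a b) := by
  obtain ⟨C, hC⟩ := exists_bound_comp hS hy hv hf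
  refine Integrable.of_bound (aestronglyMeasurable_comp hS hy hv hf) C ?_
  filter_upwards [ae_mem_lowerKappa hS] with t ht using hC t ht

/-- The restriction to `ρ(t) = t` is essential: at a left-scattered, right-dense point `ρ` jumps. -/
theorem continuousWithinAt_comp (hy : ContinuousOn y S)
    (hv : ContinuousOn v (lowerKappa S a))
    (hf : ContinuousOn (fun p : ℝ × ℝ × ℝ => f p.1 p.2.1 p.2.2) (S ×ˢ univ))
    (hS : IsClosed S) (ht : t ∈ lowerKappa S a) (hρ : rho S t = t) :
    ContinuousWithinAt (fun t => f t (y (rho S t)) (v t)) (lowerKappa S a) t := by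
  have h1 : ContinuousWithinAt (fun s => y (rho S s)) (lowerKappa S a) t := by
    refine ContinuousWithinAt.comp (t := S) ?_ ((continuousWithinAt_rho hρ).mono
      sdiff_subset) fun s hs => rho_mem hS hs.1
    rw [hρ]
    exact hy t ht.1
  have h2 : ContinuousWithinAt (fun s => (s, y (rho S s), v s)) (lowerKappa S a) t :=
    continuousWithinAt_id.prodMk (h1.prodMk (hv t ht))
  exact ContinuousWithinAt.comp (t := S ×ˢ univ) (g := fun p : ℝ × ℝ × ℝ => f p.1 p.2.1 p.2.2)
    (f := fun s => (s, y (rho S s), v s)) (hf (t, y (rho S t), v t) ⟨ht.1, trivial⟩) h2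
    fun s hs => ⟨hs.1, trivial⟩

/-- A Lagrangian is strictly differentiable in its last two variables, uniformly along a bounded
family of points. -/
theorem IsLagrangian.uniform_estimate (hf : IsLagrangian T f) {K : Set ℝ} (hK : IsCompact K)
    (hKT : K ⊆ T) {X V : ℝ → ℝ} {R : ℝ} (hX : ∀ t ∈ K, |X t| ≤ R) (hV : ∀ t ∈ K, |V t| ≤ R)
    {ε : ℝ} (hε : 0 < ε) :
    ∃ δ > 0, ∀ t ∈ K, ∀ x₁ x₂ v₁ v₂ : ℝ, |x₁ - X t| < δ → |x₂ - X t| < δ → |v₁ - V t| < δ →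
      |v₂ - V t| < δ →
      |f t x₁ v₁ - f t x₂ v₂ - partial₂ f t (X t) (V t) * (x₁ - x₂)
        - partial₃ f t (X t) (V t) * (v₁ - v₂)| ≤ ε * (|x₁ - x₂| + |v₁ - v₂|) := by
  -- The margin 1 keeps every point within `δ ≤ 1` of the curve inside one compact box, on which ∂₂
  -- and ∂₃ are uniformly continuous.
  set B : Set (ℝ × ℝ × ℝ) := K ×ˢ Icc (-(R + 1)) (R + 1) ×ˢ Icc (-(R + 1)) (R + 1) with hB
  have hBc : IsCompact B := hK.prod (isCompact_Icc.prod isCompact_Icc)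
  have hBT : B ⊆ T ×ˢ univ := prod_mono hKT (subset_univ _)
  obtain ⟨δ₂, hδ₂, H₂⟩ := Metric.uniformContinuousOn_iff.1
    (hBc.uniformContinuousOn_of_continuous (hf.continuousOn₂.mono hBT)) ε hε
  obtain ⟨δ₃, hδ₃, H₃⟩ := Metric.uniformContinuousOn_iff.1
    (hBc.uniformContinuousOn_of_continuous (hf.continuousOn₃.mono hBT)) ε hε
  refine ⟨min 1 (min δ₂ δ₃), by positivity, fun t ht x₁ x₂ v₁ v₂ hx₁ hx₂ hv₁ hv₂ => ?_⟩
  set δ := min 1 (min δ₂ δ₃) with hδ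
  have hd1 : δ ≤ 1 := min_le_left _ _
  have hd2 : δ ≤ δ₂ := (min_le_right _ _).trans (min_le_left _ _)
  have hd3 : δ ≤ δ₃ := (min_le_right _ _).trans (min_le_right _ _)
  have mem : ∀ x v, |x - X t| < δ → |v - V t| < δ → (t, x, v) ∈ B := by
    intro x v hx hv
    have h1 := abs_le.1 (hX t ht)
    have h2 := abs_le.1 (hV t ht)
    have h3 := abs_lt.1 hx
    have h4 := abs_lt.1 hv
    exact ⟨ht, ⟨by linarith, by linarith⟩, by linarith, by linarith⟩
  have hδ0 : 0 < δ := by positivity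
  have mem0 : (t, X t, V t) ∈ B := mem _ _ (by simpa using hδ0) (by simpa using hδ0)
  have hdist : ∀ x v, |x - X t| < δ → |v - V t| < δ → dist (t, x, v) (t, X t, V t) < δ := by
    intro x v hx hv
    rw [Prod.dist_eq, Prod.dist_eq, dist_self]
    exact max_lt hδ0 (max_lt hx hv)
  have conv : ∀ c : ℝ, Convex ℝ (Metric.ball c δ) := fun c => convex_ball c δ
  have e1 : |(f t x₁ v₂ - partial₂ f t (X t) (V t) * x₁)
      - (f t x₂ v₂ - partial₂ f t (X t) (V t) * x₂)| ≤ ε * |x₁ - x₂| := by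
    -- Mean value inequality in one variable at a time, after subtracting the linear part: first `x`
    -- with `v₂` fixed, then `v` with `x₁` fixed.
    refine (conv (X t)).norm_image_sub_le_of_norm_hasDerivWithin_le
      (f := fun x => f t x v₂ - partial₂ f t (X t) (V t) * x)
      (f' := fun x => partial₂ f t x v₂ - partial₂ f t (X t) (V t)) (fun x _ => ?_)
      (fun x hx => ?_) hx₂ hx₁
    · have h1 := (hf.differentiable₂ t (hKT ht) v₂ x).hasDerivAt
      have h2 := (hasDerivAt_id x).const_mul (partial₂ f t (X t) (V t))
      rw [mul_one] at h2
      exact (h1.sub h2).hasDerivWithinAt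
    · exact (H₂ _ (mem x v₂ hx hv₂) _ mem0 ((hdist x v₂ hx hv₂).trans_le hd2)).le
  have e2 : |(f t x₁ v₁ - partial₃ f t (X t) (V t) * v₁)
      - (f t x₁ v₂ - partial₃ f t (X t) (V t) * v₂)| ≤ ε * |v₁ - v₂| := by
    refine (conv (V t)).norm_image_sub_le_of_norm_hasDerivWithin_le
      (f := fun v => f t x₁ v - partial₃ f t (X t) (V t) * v)
      (f' := fun v => partial₃ f t x₁ v - partial₃ f t (X t) (V t)) (fun v _ => ?_)
      (fun v hv => ?_) hv₂ hv₁
    · have h1 := (hf.differentiable₃ t (hKT ht) x₁ v).hasDerivAt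
      have h2 := (hasDerivAt_id v).const_mul (partial₃ f t (X t) (V t))
      rw [mul_one] at h2
      exact (h1.sub h2).hasDerivWithinAt
    · exact (H₃ _ (mem x₁ v hx₁ hv) _ mem0 ((hdist x₁ v hx₁ hv).trans_le hd3)).le
  calc _ = |((f t x₁ v₂ - partial₂ f t (X t) (V t) * x₁)
      - (f t x₂ v₂ - partial₂ f t (X t) (V t) * x₂)) +
      ((f t x₁ v₁ - partial₃ f t (X t) (V t) * v₁)
      - (f t x₁ v₂ - partial₃ f t (X t) (V t) * v₂))| := by congr 1; ring
    _ ≤ _ := abs_add_le _ _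
    _ ≤ ε * |x₁ - x₂| + ε * |v₁ - v₂| := add_le_add e1 e2
    _ = _ := by ring

/-- Strict differentiability of an integral functional whose integrand is differentiable
uniformly in the parameter. -/
theorem exists_hasStrictFDerivAt_integral {E : Type*} [NormedAddCommGroup E] [NormedSpace ℝ E]
    {μ : Measure ℝ} [IsFiniteMeasure μ] {K : Set ℝ} (hK : ∀ᵐ t ∂μ, t ∈ K)
    {X V P Q : ℝ → ℝ} {A B : ℝ → E →L[ℝ] ℝ} {C M : ℝ} (hA : ∀ t ∈ K, ‖A t‖ ≤ C)
    (hB : ∀ t ∈ K, ‖B t‖ ≤ C) (hP : ∀ t ∈ K, |P t| ≤ M) (hQ : ∀ t ∈ K, |Q t| ≤ M)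
    (hint : ∀ u, Integrable (fun t => f t (X t + A t u) (V t + B t u)) μ)
    (hint' : ∀ u, Integrable (fun t => P t * A t u + Q t * B t u) μ)
    (hunif : ∀ ε > 0, ∃ δ > 0, ∀ t ∈ K, ∀ x₁ x₂ v₁ v₂ : ℝ, |x₁ - X t| < δ → |x₂ - X t| < δ →
      |v₁ - V t| < δ → |v₂ - V t| < δ →
      |f t x₁ v₁ - f t x₂ v₂ - P t * (x₁ - x₂) - Q t * (v₁ - v₂)|
        ≤ ε * (|x₁ - x₂| + |v₁ - v₂|)) :
    ∃ D : E →L[ℝ] ℝ, (∀ u, D u = ∫ t, (P t * A t u + Q t * B t u) ∂μ) ∧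
      HasStrictFDerivAt (fun u => ∫ t, f t (X t + A t u) (V t + B t u) ∂μ) D 0 := by
  rcases K.eq_empty_or_nonempty with rfl | ⟨t₀, ht₀⟩
  · have h0 : μ = 0 := by simpa using hK
    subst h0
    exact ⟨0, fun u => by simp, by simpa using hasStrictFDerivAt_const (0 : ℝ) (0 : E)⟩
  have hC0 : 0 ≤ C := (norm_nonneg _).trans (hA t₀ ht₀)
  have hM0 : 0 ≤ M := (abs_nonneg _).trans (hP t₀ ht₀)
  have hAu : ∀ t ∈ K, ∀ u, |A t u| ≤ C * ‖u‖ := fun t ht u => (A t).le_of_opNorm_le (hA t ht) u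
  have hBu : ∀ t ∈ K, ∀ u, |B t u| ≤ C * ‖u‖ := fun t ht u => (B t).le_of_opNorm_le (hB t ht) u
  let L : E →ₗ[ℝ] ℝ :=
    { toFun := fun u => ∫ t, (P t * A t u + Q t * B t u) ∂μ
      map_add' := fun u w => by
        rw [← integral_add (hint' u) (hint' w)]
        congr 1 with t
        simp only [map_add]
        ring
      map_smul' := fun c u => by
        rw [RingHom.id_apply, smul_eq_mul, ← integral_const_mul]
        congr 1 with t
        simp only [map_smul, smul_eq_mul]
        ring }
  let D : E →L[ℝ] ℝ := L.mkContinuous (2 * M * C * μ.real univ) fun u => by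
    refine (norm_integral_le_of_norm_le_const (C := 2 * M * C * ‖u‖) ?_).trans_eq (by ring)
    filter_upwards [hK] with t ht
    calc |P t * A t u + Q t * B t u| ≤ |P t * A t u| + |Q t * B t u| := abs_add_le _ _
      _ = |P t| * |A t u| + |Q t| * |B t u| := by rw [abs_mul, abs_mul]
      _ ≤ M * (C * ‖u‖) + M * (C * ‖u‖) := by
        gcongr
        exacts [hP t ht, hAu t ht u, hQ t ht, hBu t ht u]
      _ = _ := by ring
  have hD : ∀ u, D u = ∫ t, (P t * A t u + Q t * B t u) ∂μ := fun u => rfl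
  refine ⟨D, hD, .of_isLittleO ?_⟩
  rw [Asymptotics.isLittleO_iff]
  intro c hc
  have hm : 0 ≤ μ.real univ := measureReal_nonneg
  -- The integrated error is at most `ε · 2C · μ(univ) · ‖u - w‖`; the added 1 only keeps the
  -- denominator positive.
  set ε := c / (2 * C * μ.real univ + 1) with hε
  have hε0 : 0 < ε := by positivity
  have hεc : ε * (2 * C * μ.real univ) ≤ c := by
    have : ε * (2 * C * μ.real univ + 1) = c := by rw [hε]; field_simp
    linarith
  obtain ⟨δ, hδ, H⟩ := hunif ε hε0
  have hr : 0 < δ / (C + 1) := by positivity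
  filter_upwards [prod_mem_nhds (Metric.ball_mem_nhds (0 : E) hr) (Metric.ball_mem_nhds (0 : E) hr)]
    with ⟨u, w⟩ ⟨hu, hw⟩
  have small : ∀ z : E, z ∈ Metric.ball (0 : E) (δ / (C + 1)) → C * ‖z‖ < δ := by
    intro z hz
    rw [mem_ball_zero_iff, lt_div_iff₀ (by positivity)] at hz
    linarith [norm_nonneg z]
  have hu' := small u hu
  have hw' := small w hw
  dsimp only
  have hsub : Integrable (fun t => f t (X t + A t u) (V t + B t u) -
      f t (X t + A t w) (V t + B t w)) μ := (hint u).sub (hint w)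
  rw [hD, ← integral_sub (hint u) (hint w), ← integral_sub hsub (hint' _)]
  refine (norm_integral_le_of_norm_le_const (C := ε * (2 * C) * ‖u - w‖) ?_).trans ?_
  · filter_upwards [hK] with t ht
    have h1 := H t ht (X t + A t u) (X t + A t w) (V t + B t u) (V t + B t w)
      (by simpa using (hAu t ht u).trans_lt hu') (by simpa using (hAu t ht w).trans_lt hw')
      (by simpa using (hBu t ht u).trans_lt hu') (by simpa using (hBu t ht w).trans_lt hw')
    rw [add_sub_add_left_eq_sub, add_sub_add_left_eq_sub, ← map_sub, ← map_sub, sub_sub] at h1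
    refine h1.trans ?_
    calc _ ≤ ε * (C * ‖u - w‖ + C * ‖u - w‖) := by
          gcongr
          exacts [hAu t ht _, hBu t ht _]
      _ = _ := by ring
  · calc _ = ε * (2 * C * μ.real univ) * ‖u - w‖ := by ring
      _ ≤ _ := by gcongr

end Superposition

end TimeScale

end

noncomputable section

namespace TimeScale

open BoundedContinuousFunction

/-! ### Primitives, integration by parts and the du Bois-Reymond lemma. -/

section DuBoisReymond

variable {S : Set ℝ} {a b s t : ℝ} {p q : ℝ → ℝ} {C c : ℝ}

/-- The nabla primitive `u ↦ ∫_a^t u(x) ∇x` of bounded continuous functions. -/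
def primitive (S : Set ℝ) (a b t : ℝ) : (ℝ →ᵇ ℝ) →L[ℝ] ℝ :=
  LinearMap.mkContinuous
    { toFun := fun u => ∫ x in a..t, u x ∂nablaMeasure S a b
      map_add' := fun u w => by
        simp only [BoundedContinuousFunction.coe_add, Pi.add_apply]
        exact intervalIntegral.integral_add (u.integrable _).intervalIntegrable
          (w.integrable _).intervalIntegrable
      map_smul' := fun r u => by
        simp only [BoundedContinuousFunction.coe_smul, RingHom.id_apply]
        exact intervalIntegral.integral_smul r _ }
    ((nablaMeasure S a b).real univ) fun u => by
      change ‖∫ x in a..t, u x ∂nablaMeasure S a b‖ ≤ _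
      rw [intervalIntegral.norm_integral_eq_norm_integral_uIoc, mul_comm]
      refine (norm_setIntegral_le_of_norm_le_const (measure_lt_top _ _)
        fun x _ => u.norm_coe_le_norm x).trans ?_
      exact mul_le_mul_of_nonneg_left (measureReal_mono (subset_univ _)) (norm_nonneg u)

theorem primitive_apply (S : Set ℝ) (a b t : ℝ) (u : ℝ →ᵇ ℝ) :
    primitive S a b t u = ∫ x in a..t, u x ∂nablaMeasure S a b := rfl

theorem norm_primitive_le (S : Set ℝ) (a b t : ℝ) :
    ‖primitive S a b t‖ ≤ (nablaMeasure S a b).real univ :=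
  LinearMap.mkContinuous_norm_le _ measureReal_nonneg _

theorem norm_evalCLM_le (t : ℝ) : ‖(evalCLM ℝ t : (ℝ →ᵇ ℝ) →L[ℝ] ℝ)‖ ≤ 1 :=
  ContinuousLinearMap.opNorm_le_bound _ zero_le_one fun u => by
    rw [one_mul]
    exact u.norm_coe_le_norm t

theorem integrable_mul_apply {μ : Measure ℝ} {q : ℝ → ℝ} (hq : Integrable q μ) (u : ℝ →ᵇ ℝ) :
    Integrable (fun t => q t * u t) μ :=
  hq.mul_bdd (c := ‖u‖) u.continuous.aestronglyMeasurable
    (Eventually.of_forall u.norm_coe_le_norm)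

theorem abs_integral_sub_le (hS : IsCompactScale S a b)
    (hq : Integrable q (nablaMeasure S a b)) (hC : ∀ x ∈ lowerKappa S a, |q x| ≤ C)
    (hs : s ∈ S) (ht : t ∈ S) :
    |(∫ x in a..t, q x ∂nablaMeasure S a b) - ∫ x in a..s, q x ∂nablaMeasure S a b|
      ≤ C * |t - s| := by
  rw [intervalIntegral.integral_interval_sub_left hq.intervalIntegrable hq.intervalIntegrable]
  exact abs_intervalIntegral_le hS hs ht fun x hx _ => hC x hx

theorem continuousOn_integral (hS : IsCompactScale S a b)
    (hq : Integrable q (nablaMeasure S a b)) (hC : ∀ x ∈ lowerKappa S a, |q x| ≤ C) :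
    ContinuousOn (fun t => ∫ x in a..t, q x ∂nablaMeasure S a b) S := by
  refine LipschitzOnWith.continuousOn (K := C.toNNReal)
    (LipschitzOnWith.of_dist_le_mul fun s hs t ht => ?_)
  refine (abs_integral_sub_le hS hq hC ht hs).trans ?_
  rw [Real.dist_eq]
  gcongr
  exact Real.le_coe_toNNReal C

/-- Any `x` in `(a, t)` has a point of `S` strictly between it and `t`, so within `(a, b]` only `x =
t` can be sent to `t`. -/
theorem nablaMeasure_singleton (hS : IsCompactScale S a b) (hρ : rho S t = t) :
    nablaMeasure S a b {t} = 0 := by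
  rw [nablaMeasure, Measure.map_apply_of_aemeasurable (aemeasurable_ceil hS)
    (measurableSet_singleton t), Measure.restrict_apply' measurableSet_Ioc]
  refine measure_mono_null (t := {t}) ?_ (measure_singleton t)
  rintro x ⟨hx, hxa, hxb⟩
  have hx : sInf (S ∩ Ici x) = t := hx
  have hxt : x ≤ t := hx ▸ (ceil_mem hS hxb).2
  refine le_antisymm hxt ?_
  by_contra! hlt
  have hne : (S ∩ Iio t).Nonempty := ⟨a, hS.left_mem, hxa.trans hlt⟩
  rw [rho, if_pos hne] at hρ
  obtain ⟨s, hs, hxs⟩ := exists_lt_of_lt_csSup hne (show x < sSup (S ∩ Iio t) by rwa [hρ])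
  exact (hx ▸ ceil_le hs.1 hxs.le).not_gt hs.2

/-- Up to a null set, `(a, ρ(t)]` and `(-∞, t)` are the same: if `ρ(t) = t` they differ on `S` by
the null point `t`, and otherwise the gap contains no point of `S`. The indicator form is what
Fubini needs. -/
theorem primitive_rho (hS : IsCompactScale S a b) (ht : t ∈ lowerKappa S a) (u : ℝ →ᵇ ℝ) :
    primitive S a b (rho S t) u = ∫ x, (Iio t).indicator u x ∂nablaMeasure S a b := by
  rw [primitive_apply, intervalIntegral.integral_of_le
    (hS.subset (rho_mem hS.isClosed ht.1)).1, integral_indicator measurableSet_Iio]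
  refine setIntegral_congr_set ?_
  have hne : ∀ᵐ x ∂nablaMeasure S a b, rho S t = t → x ≠ t := by
    by_cases hρ : rho S t = t
    · filter_upwards [compl_mem_ae_iff.2 (nablaMeasure_singleton hS hρ)] with x hx _ using hx
    · exact Eventually.of_forall fun x h => absurd h hρ
  filter_upwards [ae_mem_Ioc hS, ae_mem_lowerKappa hS, hne] with x hx hK hne
  refine propext ⟨fun h => ?_, fun h => ⟨hx.1, le_rho hK.1 h⟩⟩
  have hle := rho_le S t
  refine lt_of_le_of_ne (h.2.trans hle) fun hxt => ?_
  exact hne (le_antisymm hle (hxt ▸ h.2)) hxt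

/-- Integration by parts against `u`. -/
theorem integral_mul_primitive (hS : IsCompactScale S a b)
    (hq : Integrable q (nablaMeasure S a b)) (u : ℝ →ᵇ ℝ) :
    ∫ t, q t * primitive S a b (rho S t) u ∂nablaMeasure S a b =
      ∫ x, u x * (∫ t in x..b, q t ∂nablaMeasure S a b) ∂nablaMeasure S a b := by
  set ν := nablaMeasure S a b
  have hprod : Integrable (fun z : ℝ × ℝ => q z.1 * u z.2) (ν.prod ν) :=
    hq.mul_prod (u.integrable ν)
  have hind : Integrable (Function.uncurry fun t x => q t * (Iio t).indicator u x)
      (ν.prod ν) := by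
    refine (hprod.indicator (measurableSet_lt measurable_snd measurable_fst)).congr
      (Eventually.of_forall fun z => ?_)
    by_cases h : z.2 < z.1
    · simp [Function.uncurry, Set.indicator, h]
    · simp [Function.uncurry, Set.indicator, h]
  -- Fubini on the triangle `x < t`.
  calc ∫ t, q t * primitive S a b (rho S t) u ∂ν
      = ∫ t, ∫ x, q t * (Iio t).indicator u x ∂ν ∂ν := by
        refine integral_congr_ae ?_
        filter_upwards [ae_mem_lowerKappa hS] with t ht
        rw [primitive_rho hS ht, integral_const_mul]
    _ = ∫ x, ∫ t, q t * (Iio t).indicator u x ∂ν ∂ν := integral_integral_swap hind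
    _ = _ := by
        refine integral_congr_ae ?_
        filter_upwards [ae_mem_Ioc hS] with x hx
        have h1 : ∀ t, q t * (Iio t).indicator u x = u x * (Ioi x).indicator q t := by
          intro t
          by_cases h : x < t
          · simp [Set.indicator, h, mul_comm]
          · simp [Set.indicator, h]
        simp_rw [h1]
        rw [integral_const_mul, integral_indicator measurableSet_Ioi,
          intervalIntegral.integral_of_le hx.2]
        congr 1
        refine setIntegral_congr_set ?_
        filter_upwards [ae_mem_Ioc hS] with t ht
        exact propext ⟨fun h => ⟨h, ht.2⟩, fun h => h.1⟩

/-- The lemma of du Bois-Reymond on a time scale. -/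
theorem duBoisReymond (hS : IsCompactScale S a b)
    (hq : Integrable q (nablaMeasure S a b)) (hC : ∀ x ∈ lowerKappa S a, |q x| ≤ C)
    (hp : Integrable p (nablaMeasure S a b))
    (hpc : ∀ t ∈ lowerKappa S a, rho S t = t → ContinuousWithinAt p (lowerKappa S a) t)
    (hqu : ∀ u : ℝ →ᵇ ℝ,
      Integrable (fun t => q t * primitive S a b (rho S t) u) (nablaMeasure S a b))
    (h : ∀ u : ℝ →ᵇ ℝ, ∫ t, (q t * primitive S a b (rho S t) u + p t * u t)
      ∂nablaMeasure S a b + c * primitive S a b b u = 0) (ht : t ∈ lowerKappa S a) :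
    p t + (∫ x in t..b, q x ∂nablaMeasure S a b) + c = 0 := by
  set ν := nablaMeasure S a b
  set W : ℝ → ℝ := fun t => ∫ x in t..b, q x ∂ν with hW
  have hWc : ContinuousOn W S := by
    have h1 : W = fun t => (∫ x in a..b, q x ∂ν) - ∫ x in a..t, q x ∂ν := by
      funext t
      rw [intervalIntegral.integral_interval_sub_left hq.intervalIntegrable
        hq.intervalIntegrable]
    rw [h1]
    exact continuousOn_const.sub (continuousOn_integral hS hq hC)
  have hWi : Integrable W ν :=
    integrable_comp (f := fun _ _ v => v) (y := 0) hS continuousOn_const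
      (hWc.mono sdiff_subset) (by fun_prop)
  have hi : Integrable (fun t => p t + W t + c) ν := (hp.add hWi).add (integrable_const c)
  have hprim : ∀ u : ℝ →ᵇ ℝ, primitive S a b b u = ∫ t, u t ∂ν := by
    intro u
    rw [primitive_apply, intervalIntegral.integral_of_le hS.lt.le]
    refine setIntegral_eq_integral_of_ae_compl_eq_zero ?_
    filter_upwards [ae_mem_Ioc hS] with x hx hn using absurd hx hn
  have h0 : ∀ u : ℝ →ᵇ ℝ, ∫ t, u t * (p t + W t + c) ∂ν = 0 := by
    intro u
    have h1 := h u
    rw [integral_add (hqu u) (integrable_mul_apply hp u), integral_mul_primitive hS hq, hprim,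
      ← integral_const_mul] at h1
    rw [← h1, ← integral_add, ← integral_add]
    · congr 1 with t
      ring
    · exact ((integrable_mul_apply hWi u).congr (Eventually.of_forall fun t => mul_comm _ _)).add
        (integrable_mul_apply hp u)
    · exact (u.integrable ν).const_mul c
    · exact (integrable_mul_apply hWi u).congr (Eventually.of_forall fun t => mul_comm _ _)
    · exact integrable_mul_apply hp u
  have hae : ∀ᵐ t ∂ν, p t + W t + c = 0 := by
    -- Smooth compactly supported test functions are bounded and continuous, hence allowed as `u`.
    refine ae_eq_zero_of_integral_contDiff_smul_eq_zero hi.locallyIntegrable fun g hg hgs => ?_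
    obtain ⟨B, hB⟩ := hgs.exists_bound_of_continuous hg.continuous
    exact h0 (ofNormedAddCommGroup g hg.continuous B hB)
  by_cases hρ : rho S t = t
  · by_contra hne
    have hcont : ContinuousWithinAt (fun t => p t + W t + c) (lowerKappa S a) t :=
      ((hpc t ht hρ).add ((hWc t ht.1).mono sdiff_subset)).add continuousWithinAt_const
    exact frequently_of_ae_of_rho_eq hS ht hρ hae (hcont.eventually_ne hne)
  · exact of_ae_of_rho_lt hS ht.1 (lt_of_le_of_ne (rho_le S t) hρ) hae

end DuBoisReymond

end TimeScale

end

noncomputable section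

namespace TimeScale

open BoundedContinuousFunction

/-! ### Variations, multipliers and the Euler–Lagrange equation. -/

section Variation

variable {S T : Set ℝ} {a b α β Λ s t : ℝ} {y : ℝ → ℝ} {f g : ℝ → ℝ → ℝ → ℝ} {u : ℝ →ᵇ ℝ}

theorem abs_primitive_sub_le (hS : IsCompactScale S a b) (u : ℝ →ᵇ ℝ) (hs : s ∈ S) (ht : t ∈ S) :
    |primitive S a b t u - primitive S a b s u| ≤ ‖u‖ * |t - s| :=
  abs_integral_sub_le hS (u.integrable _) (fun x _ => u.norm_coe_le_norm x) hs ht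

theorem primitive_left (S : Set ℝ) (a b : ℝ) (u : ℝ →ᵇ ℝ) : primitive S a b a u = 0 :=
  intervalIntegral.integral_same

theorem hasNablaDerivAt_primitive (hS : IsCompactScale S a b) (u : ℝ →ᵇ ℝ)
    (ht : t ∈ lowerKappa S a) : HasNablaDerivAt S (fun r => primitive S a b r u) (u t) t :=
  hasNablaDerivAt_integral hS (u.integrable _) (fun x _ => u.norm_coe_le_norm x) ht
    fun _ => u.continuous.continuousWithinAt

theorem IsNablaC1.nablaDeriv_add_primitive (hS : IsCompactScale S a b) (hy : IsNablaC1 S a y)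
    (u : ℝ →ᵇ ℝ) (ht : t ∈ lowerKappa S a) :
    nablaDeriv S (fun r => y r + primitive S a b r u) t = nablaDeriv S y t + u t :=
  ((hy.hasNablaDerivAt ht).add (hasNablaDerivAt_primitive hS u ht)).nablaDeriv_eq hS ht

theorem IsNablaC1.add_primitive (hS : IsCompactScale S a b) (hy : IsNablaC1 S a y)
    (u : ℝ →ᵇ ℝ) : IsNablaC1 S a (fun r => y r + primitive S a b r u) :=
  ⟨fun _ ht => ⟨_, (hy.hasNablaDerivAt ht).add (hasNablaDerivAt_primitive hS u ht)⟩,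
    (hy.2.add u.continuous.continuousOn).congr fun _ ht => hy.nablaDeriv_add_primitive hS u ht⟩

/-- Each of the two shifted terms contributes `b - a`, and each derivative contributes 1; the delta
derivative is controlled by the Lipschitz constant `‖u‖`. -/
theorem norm1_primitive_le (hS : IsCompactScale S a b) (u : ℝ →ᵇ ℝ) :
    norm1 S a b (fun t => primitive S a b t u) ≤ ENNReal.ofReal ((2 * (b - a) + 2) * ‖u‖) := by
  have hb : ∀ t ∈ S, |primitive S a b t u| ≤ (b - a) * ‖u‖ := by
    intro t ht
    have h1 := abs_primitive_sub_le hS u hS.left_mem ht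
    have h2 := hS.subset ht
    rw [primitive_left, sub_zero, abs_of_nonneg (a := t - a) (by linarith [h2.1])] at h1
    refine h1.trans ?_
    rw [mul_comm]
    gcongr
    exact h2.2
  have h1 : supNorm S a b (fun t => primitive S a b (sigma S t) u) ≤
      ENNReal.ofReal ((b - a) * ‖u‖) :=
    supNorm_le fun t ht => hb _ (sigma_mem hS.isClosed ht.1.1)
  have h2 : supNorm S a b (fun t => primitive S a b (rho S t) u) ≤
      ENNReal.ofReal ((b - a) * ‖u‖) :=
    supNorm_le fun t ht => hb _ (rho_mem hS.isClosed ht.1.1)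
  have h3 : supNorm S a b (deltaDeriv S fun t => primitive S a b t u) ≤ ENNReal.ofReal ‖u‖ :=
    supNorm_le fun t ht => abs_deltaDeriv_le hS (norm_nonneg u)
      (fun s hs t ht => abs_primitive_sub_le hS u hs ht) ht.2
  have h4 : supNorm S a b (nablaDeriv S fun t => primitive S a b t u) ≤ ENNReal.ofReal ‖u‖ :=
    supNorm_le fun t ht => by
      rw [(hasNablaDerivAt_primitive hS u ht.1).nablaDeriv_eq hS ht.1]
      exact u.norm_coe_le_norm t
  have h0 : 0 ≤ (b - a) * ‖u‖ := mul_nonneg (by linarith [hS.lt]) (norm_nonneg u)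
  refine (add_le_add (add_le_add (add_le_add h1 h2) h3) h4).trans_eq ?_
  rw [← ENNReal.ofReal_add h0 h0, ← ENNReal.ofReal_add (by positivity) (norm_nonneg u),
    ← ENNReal.ofReal_add (by positivity) (norm_nonneg u)]
  congr 1
  ring

theorem IsLagrangian.mono (hf : IsLagrangian T f) (hST : S ⊆ T) : IsLagrangian S f where
  continuousOn := hf.continuousOn.mono (prod_mono_left hST)
  differentiable₂ := fun t ht => hf.differentiable₂ t (hST ht)
  differentiable₃ := fun t ht => hf.differentiable₃ t (hST ht)
  continuousOn₂ := hf.continuousOn₂.mono (prod_mono_left hST)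
  continuousOn₃ := hf.continuousOn₃.mono (prod_mono_left hST)

theorem partial₂_combination (hf : IsLagrangian T f) (hg : IsLagrangian T g) (r l : ℝ)
    (ht : t ∈ T) (x v : ℝ) : partial₂ (fun t x v => r * f t x v - l * g t x v) t x v =
      r * partial₂ f t x v - l * partial₂ g t x v :=
  (((hf.differentiable₂ t ht v x).hasDerivAt.const_mul r).sub
    ((hg.differentiable₂ t ht v x).hasDerivAt.const_mul l)).deriv

theorem partial₃_combination (hf : IsLagrangian T f) (hg : IsLagrangian T g) (r l : ℝ)
    (ht : t ∈ T) (x v : ℝ) : partial₃ (fun t x v => r * f t x v - l * g t x v) t x v =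
      r * partial₃ f t x v - l * partial₃ g t x v :=
  (((hf.differentiable₃ t ht x v).hasDerivAt.const_mul r).sub
    ((hg.differentiable₃ t ht x v).hasDerivAt.const_mul l)).deriv

theorem IsLagrangian.combination (hf : IsLagrangian T f) (hg : IsLagrangian T g) (r l : ℝ) :
    IsLagrangian T (fun t x v => r * f t x v - l * g t x v) where
  continuousOn := (continuousOn_const.mul hf.continuousOn).sub
    (continuousOn_const.mul hg.continuousOn)
  differentiable₂ := fun t ht v => ((hf.differentiable₂ t ht v).const_mul r).sub
    ((hg.differentiable₂ t ht v).const_mul l)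
  differentiable₃ := fun t ht x => ((hf.differentiable₃ t ht x).const_mul r).sub
    ((hg.differentiable₃ t ht x).const_mul l)
  continuousOn₂ := ((continuousOn_const.mul hf.continuousOn₂).sub
    (continuousOn_const.mul hg.continuousOn₂)).congr
      fun p hp => partial₂_combination hf hg r l hp.1 p.2.1 p.2.2
  continuousOn₃ := ((continuousOn_const.mul hf.continuousOn₃).sub
    (continuousOn_const.mul hg.continuousOn₃)).congr
      fun p hp => partial₃_combination hf hg r l hp.1 p.2.1 p.2.2

theorem functional_add_primitive (hS : IsCompactScale S a b) (hf : IsLagrangian S f)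
    (hy : IsNablaC1 S a y) (u : ℝ →ᵇ ℝ) :
    functional S a b f (fun r => y r + primitive S a b r u) =
      ∫ t, f t (y (rho S t) + primitive S a b (rho S t) u)
        (nablaDeriv S y t + evalCLM ℝ t u) ∂nablaMeasure S a b := by
  have hyu := hy.add_primitive hS u
  have hm : AEStronglyMeasurable (along S f fun r => y r + primitive S a b r u)
      (nablaMeasure S a b) :=
    aestronglyMeasurable_comp hS (hyu.continuousOn hS) hyu.2 hf.continuousOn
  rw [functional, nablaIntegral_eq hS hm]
  refine integral_congr_ae ?_
  filter_upwards [ae_mem_lowerKappa hS] with t ht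
  rw [along, hy.nablaDeriv_add_primitive hS u ht]
  rfl

theorem aestronglyMeasurable_primitive_rho (hS : IsCompactScale S a b) (u : ℝ →ᵇ ℝ) :
    AEStronglyMeasurable (fun t => primitive S a b (rho S t) u) (nablaMeasure S a b) :=
  aestronglyMeasurable_comp (f := fun _ x _ => x) (y := fun r => primitive S a b r u) (v := 0) hS
    (continuousOn_integral hS (u.integrable _) fun x _ => u.norm_coe_le_norm x)
    continuousOn_const (by fun_prop)

theorem integrable_mul_primitive_rho (hS : IsCompactScale S a b) {q : ℝ → ℝ}
    (hq : Integrable q (nablaMeasure S a b)) (u : ℝ →ᵇ ℝ) :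
    Integrable (fun t => q t * primitive S a b (rho S t) u) (nablaMeasure S a b) :=
  hq.mul_bdd (c := (nablaMeasure S a b).real univ * ‖u‖) (aestronglyMeasurable_primitive_rho hS u)
    (Eventually.of_forall fun _ => (primitive S a b _).le_of_opNorm_le
      (norm_primitive_le S a b _) u)

theorem integrable_firstVariation (hS : IsCompactScale S a b) (hf : IsLagrangian S f)
    (hy : IsNablaC1 S a y) (u : ℝ →ᵇ ℝ) :
    Integrable (fun t => along S (partial₂ f) y t * primitive S a b (rho S t) u +
      along S (partial₃ f) y t * u t) (nablaMeasure S a b) :=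
  (integrable_mul_primitive_rho hS
      (integrable_comp hS (hy.continuousOn hS) hy.2 hf.continuousOn₂) u).add
    (integrable_mul_apply (integrable_comp hS (hy.continuousOn hS) hy.2 hf.continuousOn₃) u)

/-- The functional is strictly differentiable along the variations `u ↦ y + ∫_a u`. -/
theorem exists_hasStrictFDerivAt_functional (hS : IsCompactScale S a b) (hf : IsLagrangian S f)
    (hy : IsNablaC1 S a y) : ∃ D : (ℝ →ᵇ ℝ) →L[ℝ] ℝ,
      (∀ u, D u = ∫ t, (along S (partial₂ f) y t * primitive S a b (rho S t) u +
        along S (partial₃ f) y t * u t) ∂nablaMeasure S a b) ∧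
      HasStrictFDerivAt (fun u => functional S a b f (fun r => y r + primitive S a b r u)) D 0 := by
  have hyc := hy.continuousOn hS
  obtain ⟨M₂, hM₂⟩ := exists_bound_comp hS hyc hy.2 hf.continuousOn₂
  obtain ⟨M₃, hM₃⟩ := exists_bound_comp hS hyc hy.2 hf.continuousOn₃
  obtain ⟨R₁, hR₁⟩ := exists_bound_comp (f := fun _ x _ => x) hS hyc hy.2 (by fun_prop)
  obtain ⟨R₂, hR₂⟩ := exists_bound_comp (f := fun _ _ v => v) hS hyc hy.2 (by fun_prop)
  have hm : 0 ≤ (nablaMeasure S a b).real univ := measureReal_nonneg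
  have hint : ∀ u, Integrable (fun t => f t (y (rho S t) + primitive S a b (rho S t) u)
      (nablaDeriv S y t + evalCLM ℝ t u)) (nablaMeasure S a b) := fun u =>
    integrable_comp hS ((hy.add_primitive hS u).continuousOn hS)
      (hy.2.add u.continuous.continuousOn) hf.continuousOn
  obtain ⟨D, hD, hD'⟩ := exists_hasStrictFDerivAt_integral (ae_mem_lowerKappa hS)
    (P := along S (partial₂ f) y) (Q := along S (partial₃ f) y)
    (A := fun t => primitive S a b (rho S t)) (B := fun t => evalCLM ℝ t)
    (C := (nablaMeasure S a b).real univ + 1) (M := max M₂ M₃)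
    (fun t _ => (norm_primitive_le S a b _).trans (by linarith))
    (fun t _ => (norm_evalCLM_le t).trans (by linarith))
    (fun t ht => (hM₂ t ht).trans (le_max_left _ _))
    (fun t ht => (hM₃ t ht).trans (le_max_right _ _)) hint
    (fun u => integrable_firstVariation hS hf hy u)
    (fun ε hε => hf.uniform_estimate (isCompact_lowerKappa hS) sdiff_subset
      (fun t ht => (hR₁ t ht).trans (le_max_left R₁ R₂))
      (fun t ht => (hR₂ t ht).trans (le_max_right R₁ R₂)) hε)
  refine ⟨D, hD, ?_⟩
  simpa only [functional_add_primitive hS hf hy] using hD'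

/-- Carries extremality from the ‖·‖_{1,∞}-ball of admissible functions to a sup-norm ball of `u`;
`A` stands for the constraint set in the space of `u`. -/
theorem isLocalExtrOn_functional (hS : IsCompactScale S a b)
    (hy : IsLocalMinimizer S a b α β Λ f g y ∨ IsLocalMaximizer S a b α β Λ f g y)
    {A : Set (ℝ →ᵇ ℝ)} (hA : ∀ u ∈ A, primitive S a b b u = 0 ∧
      functional S a b g (fun r => y r + primitive S a b r u) = Λ) :
    IsLocalExtrOn (fun u => functional S a b f (fun r => y r + primitive S a b r u)) A 0 := by
  have hadm : IsAdmissible S a b α β Λ g y → ∀ u ∈ A,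
      IsAdmissible S a b α β Λ g (fun r => y r + primitive S a b r u) := fun h u hu =>
    ⟨h.isNablaC1.add_primitive hS u, by rw [primitive_left, add_zero, h.left],
      by rw [(hA u hu).1, add_zero, h.right], (hA u hu).2⟩
  have hsmall : ∀ δ : ℝ, 0 < δ → ∀ᶠ u in 𝓝[A] (0 : ℝ →ᵇ ℝ), u ∈ A ∧
      norm1 S a b (fun t => y t + primitive S a b t u - y t) < ENNReal.ofReal δ := by
    intro δ hδ
    have hpos : 0 < 2 * (b - a) + 2 := by linarith [hS.lt]
    filter_upwards [self_mem_nhdsWithin,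
      mem_nhdsWithin_of_mem_nhds (Metric.ball_mem_nhds 0 (div_pos hδ hpos))] with u hu hb
    refine ⟨hu, ?_⟩
    simp only [add_sub_cancel_left]
    refine (norm1_primitive_le hS u).trans_lt ((ENNReal.ofReal_lt_ofReal_iff hδ).2 ?_)
    rw [mem_ball_zero_iff, lt_div_iff₀ hpos] at hb
    rwa [mul_comm]
  rcases hy with ⟨h, δ, hδ, H⟩ | ⟨h, δ, hδ, H⟩
  · left
    filter_upwards [hsmall δ hδ] with u hu
    simpa using H _ (hadm h u hu.1) hu.2
  · right
    filter_upwards [hsmall δ hδ] with u hu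
    simpa using H _ (hadm h u hu.1) hu.2

theorem exists_multipliers (hS : IsCompactScale S a b) (hf : IsLagrangian S f)
    (hg : IsLagrangian S g)
    (hy : IsLocalMinimizer S a b α β Λ f g y ∨ IsLocalMaximizer S a b α β Λ f g y) :
    ∃ r l c : ℝ, ¬(r = 0 ∧ l = 0) ∧ ∀ u : ℝ →ᵇ ℝ,
      ∫ t, (along S (partial₂ fun t x v => r * f t x v - l * g t x v) y t *
          primitive S a b (rho S t) u +
        along S (partial₃ fun t x v => r * f t x v - l * g t x v) y t * u t)
          ∂nablaMeasure S a b + c * primitive S a b b u = 0 := by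
  have hadm : IsAdmissible S a b α β Λ g y := hy.elim And.left And.left
  have hC1 := hadm.isNablaC1
  obtain ⟨Df, hDf, hDf'⟩ := exists_hasStrictFDerivAt_functional hS hf hC1
  obtain ⟨Dg, hDg, hDg'⟩ := exists_hasStrictFDerivAt_functional hS hg hC1
  obtain ⟨L, r, hne, hL⟩ := IsLocalExtrOn.exists_multipliers_of_hasStrictFDerivAt
    (f := ![fun u => functional S a b g (fun r => y r + primitive S a b r u),
      fun u => primitive S a b b u]) (f' := ![Dg, primitive S a b b])
    (isLocalExtrOn_functional hS hy fun u hu => by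
      have h0 := hu 0
      have h1 := hu 1
      simp only [Matrix.cons_val_zero, Matrix.cons_val_one, map_zero, add_zero] at h0 h1
      exact ⟨h1, h0.trans hadm.constraint⟩)
    (by
      intro i
      fin_cases i
      · exact hDg'
      · exact (primitive S a b b).hasStrictFDerivAt) hDf'
  have hsum : ∀ u, L 0 * Dg u + L 1 * primitive S a b b u + r * Df u = 0 := by
    intro u
    have := DFunLike.congr_fun hL u
    simpa [Fin.sum_univ_two] using this
  -- The sign comes from `G = λ₀ f - λ g`; `L 1` belongs to the endpoint condition `U(b) = 0`.
  refine ⟨r, -L 0, L 1, ?_, fun u => ?_⟩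
  · rintro ⟨hr, hl⟩
    have hl : L 0 = 0 := by linarith
    -- If `r = L 0 = 0`, then `u = 1` yields `L 1 * (b - a) = 0`, so all multipliers would vanish.
    have h1 := hsum (BoundedContinuousFunction.const ℝ 1)
    have h2 : primitive S a b b (BoundedContinuousFunction.const ℝ 1) = b - a := by
      rw [primitive_apply]
      simpa using intervalIntegral_const hS hS.left_mem hS.right_mem 1
    rw [hr, hl, h2] at h1
    have h3 : L 1 = 0 := by
      have := hS.lt
      rcases mul_eq_zero.1 (show L 1 * (b - a) = 0 by linarith) with h | h
      · exact h
      · linarith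
    refine hne (Prod.ext (funext fun i => ?_) hr)
    fin_cases i
    · exact hl
    · exact h3
  · have h1 : ∫ t, (along S (partial₂ fun t x v => r * f t x v - -L 0 * g t x v) y t *
          primitive S a b (rho S t) u +
        along S (partial₃ fun t x v => r * f t x v - -L 0 * g t x v) y t * u t)
          ∂nablaMeasure S a b = r * Df u + L 0 * Dg u := by
      rw [hDf, hDg, ← integral_const_mul, ← integral_const_mul,
        ← integral_add ((integrable_firstVariation hS hf hC1 u).const_mul r)
          ((integrable_firstVariation hS hg hC1 u).const_mul (L 0))]
      refine integral_congr_ae ?_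
      filter_upwards [ae_mem_lowerKappa hS] with t ht
      simp only [along, partial₂_combination hf hg _ _ ht.1, partial₃_combination hf hg _ _ ht.1]
      ring
    rw [h1]
    linarith [hsum u]

/-- The nabla Euler–Lagrange equation from the vanishing of the first variation. -/
theorem eulerLagrange_of_firstVariation (hS : IsCompactScale S a b) (hf : IsLagrangian S f)
    (hy : IsNablaC1 S a y) {c : ℝ}
    (h : ∀ u : ℝ →ᵇ ℝ, ∫ t, (along S (partial₂ f) y t * primitive S a b (rho S t) u +
      along S (partial₃ f) y t * u t) ∂nablaMeasure S a b + c * primitive S a b b u = 0) :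
    EulerLagrange S a f y := by
  have hyc := hy.continuousOn hS
  have hq : Integrable (along S (partial₂ f) y) (nablaMeasure S a b) :=
    integrable_comp hS hyc hy.2 hf.continuousOn₂
  have hp : Integrable (along S (partial₃ f) y) (nablaMeasure S a b) :=
    integrable_comp hS hyc hy.2 hf.continuousOn₃
  obtain ⟨C, hC⟩ := exists_bound_comp hS hyc hy.2 hf.continuousOn₂
  have key : ∀ t ∈ lowerKappa S a, _ := fun t ht => duBoisReymond hS hq hC hp
    (fun t ht hρ => continuousWithinAt_comp hyc hy.2 hf.continuousOn₃ hS.isClosed ht hρ)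
    (integrable_mul_primitive_rho hS hq) h ht
  -- The du Bois-Reymond identity solved for `∂₃G{y}`; the formula is defined at `a` too, even when
  -- `a` is right-scattered.
  refine ⟨fun t => (∫ x in a..t, along S (partial₂ f) y x ∂nablaMeasure S a b) +
    (-(∫ x in a..b, along S (partial₂ f) y x ∂nablaMeasure S a b) - c), fun t ht => ?_,
    fun t ht => ?_⟩
  · have h1 := key t ht
    rw [← intervalIntegral.integral_interval_sub_left (a := a) hq.intervalIntegrable
      hq.intervalIntegrable] at h1
    linarith
  · have h1 := (hasNablaDerivAt_integral hS hq hC ht fun hρ => continuousWithinAt_comp hyc hy.2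
      hf.continuousOn₂ hS.isClosed ht hρ).add (hasNablaDerivAt_const S
        (-(∫ x in a..b, along S (partial₂ f) y x ∂nablaMeasure S a b) - c) t)
    rwa [add_zero] at h1

end Variation

end TimeScale

end

theorem corollary2 (T : Set ℝ) (hT : IsTimeScale T) (a b : ℝ) (ha : a ∈ T) (hb : b ∈ T)
    (hab : a < b) (α β Λ : ℝ) (f g : ℝ → ℝ → ℝ → ℝ) (hf : IsLagrangian T f)
    (hg : IsLagrangian T g) (yh : ℝ → ℝ)
    (hyh : IsLocalMinimizer (interval T a b) a b α β Λ f g yh ∨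
      IsLocalMaximizer (interval T a b) a b α β Λ f g yh) :
    ∃ lam₀ lam : ℝ, ¬(lam₀ = 0 ∧ lam = 0) ∧
      EulerLagrange (interval T a b) a (fun t x v => lam₀ * f t x v - lam * g t x v) yh := by
  have hS := isCompactScale_interval hT ha hb hab
  have hf' := hf.mono (inter_subset_right : interval T a b ⊆ T)
  have hg' := hg.mono (inter_subset_right : interval T a b ⊆ T)
  obtain ⟨r, l, c, hne, h⟩ := exists_multipliers hS hf' hg' hyh
  exact ⟨r, l, hne, eulerLagrange_of_firstVariation hS (hf'.combination hg' r l)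
    (hyh.elim And.left And.left).isNablaC1 h⟩
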